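/- Let $\alpha,\beta\in\mathbb C$ with $\|\alpha\|=\|\beta\|>1$, and let $H_{\alpha,\beta}=(\mathbb C^2\setminus 0)/\langle (z_1,z_2)\mapsto(\alpha z_1,\beta z_2)\rangle$ be the associated Hopf surface with its complex structure $J$. Write $S^3=\{(\xi_1,\xi_2)\in\mathbb C^2:\|\xi_1\|^2+\|\xi_2\|^2=1\}$, $S^1=\mathbb R/2\pi\mathbb Z$, and identify $S^1\times S^3$ with $H_{\alpha,\beta}$ by the diffeomorphism $$F_{\alpha,\beta}(\theta,(\xi_1,\xi_2))=\bigl[e^{\frac{\theta\log\alpha}{2\pi}}\xi_1,\;e^{\frac{\theta\log\beta}{2\pi}}\xi_2\bigr].$$ Let $e_2=(i\xi_1,i\xi_2)$ and $e_3=(-\bar\xi_2,\bar\xi_1)$ be the vector fields on $S^1\times S^3$ tangent to the factor $S^3$; they form a complex basis of the tangent spaces of $H_{\alpha,\beta}$. Let $k:\mathbb R\to\mathbb R$ be any smooth, positive, $2\pi$-periodic function of $\theta$ (i.e. a smooth positive function on $S^1$). Then there is exactly one smooth Hermitian metric $g_k$ on $H_{\alpha,\beta}$ whose matrix in the complex basis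 $(e_2,e_3)$ is $$\begin{pmatrix}k(\theta)&0\\0&1\end{pmatrix}$$ at every point $(\theta,(\xi_1,\xi_2))$. The metric $g_k$ is locally conformally Kähler: $H_{\alpha,\beta}$ is covered by open sets $U$ carrying smooth functions $f:U\to\mathbb R$ such that $e^{-f}g_k|_U$ is Kähler. Moreover $g_k$ is Vaisman, i.e. its Lee form (the $1$-form given locally by $\omega=df$) is parallel for the Levi-Civita connection of $g_k$, if and only if $k$ is constant. -/

import Mathlib

open scoped Manifold ContDiff Topology

noncomputable section LocallyConformalKaehler

/-! ### Hermitian, l.c.K. and Vaisman metrics on complex manifolds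

`M` is a complex manifold modelled on the complex normed space `E`.  All tensors are real tensors on
the real tangent spaces `TangentSpace 𝓘(ℝ, E) p`. Exterior derivatives and covariant derivatives are
computed in all charts of the atlas. -/

variable {E : Type*} [NormedAddCommGroup E] [NormedSpace ℂ E] [NormedSpace ℝ E]
  [IsScalarTower ℝ ℂ E] {M : Type*} [TopologicalSpace M] [ChartedSpace E M]

/-- The complex structure `J` on the real tangent space at `p`: multiplication by `i`. -/
def complexStructure (p : M) : TangentSpace 𝓘(ℝ, E) p →L[ℝ] TangentSpace 𝓘(ℝ, E) p :=
  show E →L[ℝ] E from (Complex.I • ContinuousLinearMap.id ℂ E).restrictScalars ℝ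

/-- The coordinate expression, in the chart `e`, of a field `η` of linear forms on `M`: its pull-back
by `e⁻¹`. -/
def chartForm (η : ∀ p : M, TangentSpace 𝓘(ℝ, E) p →L[ℝ] ℝ) (e : OpenPartialHomeomorph M E)
    (x : E) : E →L[ℝ] ℝ :=
  (η (e.symm x)).comp (mfderiv 𝓘(ℝ, E) 𝓘(ℝ, E) e.symm x : E →L[ℝ] TangentSpace 𝓘(ℝ, E) (e.symm x))

/-- The coordinate expression, in the chart `e`, of a field `B` of bilinear forms on `M`: its
pull-back by `e⁻¹`. -/
def chartBilin
    (B : ∀ p : M, TangentSpace 𝓘(ℝ, E) p →L[ℝ] TangentSpace 𝓘(ℝ, E) p →L[ℝ] ℝ)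
    (e : OpenPartialHomeomorph M E) (x : E) : E →L[ℝ] E →L[ℝ] ℝ :=
  let D : E →L[ℝ] E := mfderiv 𝓘(ℝ, E) 𝓘(ℝ, E) e.symm x
  ContinuousLinearMap.bilinearComp (show E →L[ℝ] E →L[ℝ] ℝ from B (e.symm x)) D D

/-- A field `Ω` of alternating bilinear forms on `M` is closed on `U`: in every chart,
`dΩ(u, v, w) = D_u Ω(v, w) - D_v Ω(u, w) + D_w Ω(u, v)` vanishes at the points of `U`. -/
def IsClosedTwoFormOn
    (Ω : ∀ p : M, TangentSpace 𝓘(ℝ, E) p →L[ℝ] TangentSpace 𝓘(ℝ, E) p →L[ℝ] ℝ)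
    (U : Set M) : Prop :=
  ∀ e ∈ atlas E M, ∀ x ∈ e.target, e.symm x ∈ U → ∀ u v w : E,
    fderiv ℝ (chartBilin Ω e) x u v w - fderiv ℝ (chartBilin Ω e) x v u w
      + fderiv ℝ (chartBilin Ω e) x w u v = 0

/-- The Christoffel symbols of a metric `G` in coordinates: `christoffel G x u v` is the vector `Γ` with
`G(Γ, w) = (D_u G(v, w) + D_v G(u, w) - D_w G(u, v)) / 2` for all `w`. -/
def christoffel (G : E → E →L[ℝ] E →L[ℝ] ℝ) (x u v : E) : E :=
  (G x).inverse ((1 / 2 : ℝ) • (fderiv ℝ G x u v + fderiv ℝ G x v u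
    - ((fderiv ℝ G x).flip u).flip v))

variable [IsManifold 𝓘(ℝ, E) ∞ M]

variable (E M) in
/-- Smooth Riemannian metrics on (the smooth manifold underlying) `M`. -/
abbrev SmoothMetric : Type _ :=
  Bundle.ContMDiffRiemannianMetric 𝓘(ℝ, E) ∞ E (fun p : M ↦ TangentSpace 𝓘(ℝ, E) p)

/-- `g` is a Hermitian metric: `g(JX, JY) = g(X, Y)`. -/
def IsHermitianMetric (g : SmoothMetric E M) : Prop :=
  ∀ (p : M) (X Y : TangentSpace 𝓘(ℝ, E) p),
    g.inner p (complexStructure p X) (complexStructure p Y) = g.inner p X Y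

/-- The fundamental form `Ω(X, Y) = g(JX, Y)`. -/
def fundamentalForm (g : SmoothMetric E M) (p : M) :
    TangentSpace 𝓘(ℝ, E) p →L[ℝ] TangentSpace 𝓘(ℝ, E) p →L[ℝ] ℝ :=
  (g.inner p).comp (complexStructure p)

/-- The complex-valued Hermitian form `H(X, Y) = g(X, Y) - i Ω(X, Y)`, linear over `ℂ` in `X`. -/
def hermitianForm (g : SmoothMetric E M) (p : M) (X Y : TangentSpace 𝓘(ℝ, E) p) : ℂ :=
  (g.inner p X Y : ℂ) - Complex.I * (fundamentalForm g p X Y : ℂ)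

/-- `f` is smooth on the open set `U` and the Hermitian metric `e^{-f} g` on `U` is Kähler, i.e. its
fundamental form `e^{-f} Ω` is closed on `U`. -/
def IsKaehlerFactorOn (g : SmoothMetric E M) (f : M → ℝ) (U : Set M) : Prop :=
  IsOpen U ∧ ContMDiffOn 𝓘(ℝ, E) 𝓘(ℝ, ℝ) ∞ f U ∧
    IsClosedTwoFormOn (fun p ↦ Real.exp (-f p) • fundamentalForm g p) U

/-- `g` is a locally conformal Kähler metric. -/
def IsLCK (g : SmoothMetric E M) : Prop :=
  IsHermitianMetric g ∧ ∀ p : M, ∃ (U : Set M) (f : M → ℝ), p ∈ U ∧ IsKaehlerFactorOn g f U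

/-- `η` is a Lee form of `g`: locally `η = df` with `e^{-f} g` Kähler. -/
def IsLeeForm (g : SmoothMetric E M) (η : ∀ p : M, TangentSpace 𝓘(ℝ, E) p →L[ℝ] ℝ) : Prop :=
  ∀ p : M, ∃ (U : Set M) (f : M → ℝ), p ∈ U ∧ IsKaehlerFactorOn g f U ∧
    ∀ q ∈ U, η q = mvfderiv 𝓘(ℝ, E) f q

/-- `∇η = 0` for the Levi-Civita connection `∇` of `g`: in every chart,
`(∇_u η)(v) = D_u η(v) - η(Γ(u, v))` vanishes. -/
def IsParallelForm (g : SmoothMetric E M) (η : ∀ p : M, TangentSpace 𝓘(ℝ, E) p →L[ℝ] ℝ) : Prop :=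
  ∀ e ∈ atlas E M, ∀ x ∈ e.target, ∀ u v : E,
    fderiv ℝ (chartForm η e) x u v - chartForm η e x (christoffel (chartBilin g.inner e) x u v) = 0

/-- `g` is a Vaisman metric: an l.c.K. metric whose Lee form is parallel. -/
def IsVaisman (g : SmoothMetric E M) : Prop :=
  IsLCK g ∧ ∃ η : ∀ p : M, TangentSpace 𝓘(ℝ, E) p →L[ℝ] ℝ, IsLeeForm g η ∧ IsParallelForm g η

end LocallyConformalKaehler

noncomputable section HopfSurfaces

/-- `ℂ²`. -/
abbrev CTwo : Type := EuclideanSpace ℂ (Fin 2)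

/-- `ℂ² ∖ 0`, an open subset of `ℂ²`. -/
def puncturedCTwo : TopologicalSpace.Opens CTwo := ⟨{0}ᶜ, isOpen_compl_singleton⟩

theorem diag_ne_zero {a b : ℂ} (ha : a ≠ 0) (hb : b ≠ 0) {z : CTwo} (hz : z ≠ 0) :
    (!₂[a * z 0, b * z 1] : CTwo) ≠ 0 := by
  intro h
  apply hz
  have h0 := congrArg (fun w : CTwo ↦ w 0) h
  have h1 := congrArg (fun w : CTwo ↦ w 1) h
  ext i
  fin_cases i
  · simpa [ha] using h0
  · simpa [hb] using h1

/-- The unit sphere `S³` of `ℂ²`. -/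
abbrev SThree : Set CTwo := Metric.sphere 0 1

/-- The map `F(θ, (ξ₁, ξ₂)) = (e^{θ log α / 2π} ξ₁, e^{θ log β / 2π} ξ₂)`, on `ℝ × ℂ²`. -/
def hopfF (α β : ℂ) (q : ℝ × CTwo) : CTwo :=
  !₂[Complex.exp (q.1 * Complex.log α / (2 * Real.pi)) * q.2 0,
    Complex.exp (q.1 * Complex.log β / (2 * Real.pi)) * q.2 1]

theorem hopfF_ne_zero (α β : ℂ) (θ : ℝ) (ξ : SThree) : hopfF α β (θ, ξ) ≠ 0 :=
  diag_ne_zero (Complex.exp_ne_zero _) (Complex.exp_ne_zero _) (by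
    exact ne_zero_of_mem_unit_sphere ξ)

variable (α β : ℂ) [hα : Fact (1 < ‖α‖)] [hβ : Fact (1 < ‖β‖)]

theorem ne_zero_of_one_lt_norm (a : ℂ) [h : Fact (1 < ‖a‖)] : a ≠ 0 :=
  norm_pos_iff.mp (one_pos.trans h.out)

/-- The automorphism `(z₁, z₂) ↦ (α z₁, β z₂)` of `ℂ² ∖ 0`. -/
def hopfPerm : Equiv.Perm puncturedCTwo where
  toFun z := ⟨!₂[α * z.1 0, β * z.1 1],
    diag_ne_zero (ne_zero_of_one_lt_norm α) (ne_zero_of_one_lt_norm β) z.2⟩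
  invFun z := ⟨!₂[α⁻¹ * z.1 0, β⁻¹ * z.1 1],
    diag_ne_zero (inv_ne_zero (ne_zero_of_one_lt_norm α)) (inv_ne_zero (ne_zero_of_one_lt_norm β)) z.2⟩
  left_inv z := by
    apply Subtype.ext
    ext i
    fin_cases i <;> simp [ne_zero_of_one_lt_norm α, ne_zero_of_one_lt_norm β]
  right_inv z := by
    apply Subtype.ext
    ext i
    fin_cases i <;> simp [ne_zero_of_one_lt_norm α, ne_zero_of_one_lt_norm β]

/-- The cyclic group generated by `(z₁, z₂) ↦ (α z₁, β z₂)`. -/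
abbrev HopfGroup : Subgroup (Equiv.Perm puncturedCTwo) := Subgroup.zpowers (hopfPerm α β)

theorem hopfPerm_zpow (n : ℤ) (z : puncturedCTwo) :
    ((hopfPerm α β ^ n) z : CTwo) = !₂[α ^ n * z.1 0, β ^ n * z.1 1] := by
  have ha := ne_zero_of_one_lt_norm α
  have hb := ne_zero_of_one_lt_norm β
  induction n generalizing z with
  | zero => ext i; fin_cases i <;> simp
  | succ n ih =>
    rw [zpow_add_one, Equiv.Perm.mul_apply, ih]
    ext i
    fin_cases i <;> simp [hopfPerm, zpow_add_one₀ ha, zpow_add_one₀ hb, mul_assoc]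
  | pred n ih =>
    rw [zpow_sub_one, Equiv.Perm.mul_apply, ih]
    ext i
    fin_cases i <;> simp [hopfPerm, zpow_sub_one₀ ha, zpow_sub_one₀ hb, mul_assoc, Equiv.Perm.inv_def]

theorem hopfGroup_smul (γ : HopfGroup α β) :
    ∃ n : ℤ, hopfPerm α β ^ n = γ ∧
      ∀ z : puncturedCTwo, ((γ • z : puncturedCTwo) : CTwo) = !₂[α ^ n * z.1 0, β ^ n * z.1 1] := by
  obtain ⟨n, hn⟩ := Subgroup.mem_zpowers_iff.mp γ.2
  refine ⟨n, hn, fun z ↦ ?_⟩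
  rw [← hopfPerm_zpow, hn]
  rfl

theorem exists_ne_zero (z : puncturedCTwo) : z.1 0 ≠ 0 ∨ z.1 1 ≠ 0 := by
  by_contra! h
  apply z.2
  ext i
  fin_cases i
  · simpa using h.1
  · simpa using h.2

instance : IsCancelSMul (HopfGroup α β) puncturedCTwo where
  left_cancel' γ z w h := MulAction.injective γ h
  right_cancel' γ δ z h := by
    obtain ⟨n, hn, hn'⟩ := hopfGroup_smul α β γ
    obtain ⟨m, hm, hm'⟩ := hopfGroup_smul α β δ
    have h2 : (!₂[α ^ n * z.1 0, β ^ n * z.1 1] : CTwo) = !₂[α ^ m * z.1 0, β ^ m * z.1 1] := by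
      rw [← hn', ← hm', h]
    have h0 := congrArg (fun w : CTwo ↦ ‖w 0‖) h2
    have h1 := congrArg (fun w : CTwo ↦ ‖w 1‖) h2
    have hnm : n = m := by
      rcases exists_ne_zero z with hz | hz
      · simp [hz] at h0
        exact (zpow_right_injective₀ (one_pos.trans hα.out) hα.out.ne') h0
      · simp [hz] at h1
        exact (zpow_right_injective₀ (one_pos.trans hβ.out) hβ.out.ne') h1
    apply Subtype.ext
    rw [← hn, ← hm, hnm]

instance : ContinuousConstSMul (HopfGroup α β) puncturedCTwo where
  continuous_const_smul γ := by
    obtain ⟨n, -, hn⟩ := hopfGroup_smul α β γ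
    rw [continuous_induced_rng]
    have : (Subtype.val ∘ fun z : puncturedCTwo ↦ γ • z) =
        fun z : puncturedCTwo ↦ (!₂[α ^ n * z.1 0, β ^ n * z.1 1] : CTwo) := funext hn
    rw [this]
    refine (PiLp.continuous_toLp 2 _).comp (continuous_pi fun i ↦ ?_)
    fin_cases i
    · simp only [Fin.zero_eta, Matrix.cons_val_zero]; fun_prop
    · simp only [Fin.mk_one, Matrix.cons_val_one]; fun_prop

instance : LocallyCompactSpace puncturedCTwo := puncturedCTwo.isOpen.locallyCompactSpace

instance : ProperlyDiscontinuousSMul (HopfGroup α β) puncturedCTwo where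
  finite_disjoint_inter_image := by
    intro K L hK hL
    let s : puncturedCTwo → ℝ := fun z ↦ max ‖z.1 0‖ ‖z.1 1‖
    have hs : Continuous s := by
      have h0 : Continuous fun z : puncturedCTwo ↦ z.1 0 := by fun_prop
      have h1 : Continuous fun z : puncturedCTwo ↦ z.1 1 := by fun_prop
      exact h0.norm.max h1.norm
    have hspos : ∀ z, 0 < s z := by
      intro z
      rcases exists_ne_zero z with hz | hz
      · exact lt_max_of_lt_left (norm_pos_iff.mpr hz)
      · exact lt_max_of_lt_right (norm_pos_iff.mpr hz)
    have hKL : IsCompact (K ∪ L) := hK.union hL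
    obtain ⟨b, hb⟩ := (hKL.image hs).bddAbove
    obtain ⟨a, ha, hab⟩ : ∃ a : ℝ, 0 < a ∧ ∀ z ∈ K ∪ L, a ≤ s z := by
      rcases (K ∪ L).eq_empty_or_nonempty with he | hne
      · exact ⟨1, one_pos, by simp [he]⟩
      · obtain ⟨z, hz, hz'⟩ := hKL.exists_isMinOn hne hs.continuousOn
        exact ⟨s z, hspos z, fun w hw ↦ hz' hw⟩
    let c : ℝ := min ‖α‖ ‖β‖
    have hc : 1 < c := lt_min hα.out hβ.out
    have hgrow : ∀ (n : ℕ) (z w : puncturedCTwo),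
        w.1 = !₂[α ^ n * z.1 0, β ^ n * z.1 1] → c ^ n * s z ≤ s w := by
      intro n z w hw
      have hw0 : ‖w.1 0‖ = ‖α‖ ^ n * ‖z.1 0‖ := by simp [hw]
      have hw1 : ‖w.1 1‖ = ‖β‖ ^ n * ‖z.1 1‖ := by simp [hw]
      have hc0 : c ^ n ≤ ‖α‖ ^ n := pow_le_pow_left₀ (by linarith) (min_le_left _ _) n
      have hc1 : c ^ n ≤ ‖β‖ ^ n := pow_le_pow_left₀ (by linarith) (min_le_right _ _) n
      have hcn : 0 ≤ c ^ n := by positivity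
      simp only [s, hw0, hw1, mul_max_of_nonneg _ _ hcn]
      exact max_le_max (by gcongr) (by gcongr)
    obtain ⟨k, hk⟩ := pow_unbounded_of_one_lt (b / a) hc
    have hbound : ∀ (n : ℕ) (z w : puncturedCTwo), z ∈ K ∪ L → w ∈ K ∪ L →
        w.1 = !₂[α ^ n * z.1 0, β ^ n * z.1 1] → n < k := by
      intro n z w hz hw h
      have h1 : c ^ n * a ≤ b := calc
        c ^ n * a ≤ c ^ n * s z := by gcongr; exact hab z hz
        _ ≤ s w := hgrow n z w h
        _ ≤ b := hb ⟨w, hw, rfl⟩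
      have h2 : c ^ n < c ^ k := lt_of_le_of_lt ((le_div_iff₀ ha).mpr h1) hk
      exact (pow_lt_pow_iff_right₀ hc).mp h2
    refine ((Set.finite_Ioo (-(k : ℤ)) k).image
      (fun n ↦ (⟨hopfPerm α β ^ n, Subgroup.zpow_mem_zpowers _ n⟩ : HopfGroup α β))).subset ?_
    rintro γ ⟨w, ⟨z, hz, hzw⟩, hw⟩
    obtain ⟨n, hn, hn'⟩ := hopfGroup_smul α β γ
    have hwz : w.1 = !₂[α ^ n * z.1 0, β ^ n * z.1 1] := by rw [← hn', ← hzw]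
    refine ⟨n, ?_, Subtype.ext hn⟩
    have hα0 := ne_zero_of_one_lt_norm α
    have hβ0 := ne_zero_of_one_lt_norm β
    obtain ⟨m, rfl | rfl⟩ := n.eq_nat_or_neg
    · have := hbound m z w (Or.inl hz) (Or.inr hw) (by simpa using hwz)
      simp only [Set.mem_Ioo]
      omega
    · have := hbound m w z (Or.inr hw) (Or.inl hz) (by
        rw [hwz]
        ext i
        fin_cases i <;> simp [hα0, hβ0])
      simp only [Set.mem_Ioo]
      omega

/-- The Hopf surface `H_{α,β} = (ℂ² ∖ 0) / ⟨(z₁, z₂) ↦ (α z₁, β z₂)⟩`. -/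
abbrev HopfSurface : Type := MulAction.orbitRel.Quotient (HopfGroup α β) puncturedCTwo

theorem chartAt_puncturedCTwo_apply (z w : puncturedCTwo) : chartAt CTwo z w = w.1 := rfl

theorem chartAt_puncturedCTwo_target (z : puncturedCTwo) :
    (chartAt CTwo z).target = (puncturedCTwo : Set CTwo) := by
  have h : (chartAt CTwo z) =
      (chartAt CTwo z.1).subtypeRestr (s := puncturedCTwo) ⟨z⟩ := rfl
  rw [h, OpenPartialHomeomorph.subtypeRestr]
  simp [chartAt_self_eq]

theorem chartAt_puncturedCTwo_symm_apply (z : puncturedCTwo) {x : CTwo}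
    (hx : x ∈ (puncturedCTwo : Set CTwo)) : ((chartAt CTwo z).symm x : CTwo) = x := by
  have h := (chartAt CTwo z).right_inv (x := x) (by rwa [chartAt_puncturedCTwo_target])
  exact h

/-- The projection `ℂ² ∖ 0 → H_{α,β}`. -/
def hopfProj (z : puncturedCTwo) : HopfSurface α β := Quotient.mk _ z

theorem isLocalHomeomorph_hopfProj : IsLocalHomeomorph (hopfProj α β) :=
  (isQuotientCoveringMap_quotientMk_of_properlyDiscontinuousSMul
    (E := puncturedCTwo) (G := HopfGroup α β)).isCoveringMap.isLocalHomeomorph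

theorem mem_atlas_hopfSurface {e : OpenPartialHomeomorph (HopfSurface α β) CTwo}
    (he : e ∈ atlas CTwo (HopfSurface α β)) : ∃ z : puncturedCTwo,
      e = ((isLocalHomeomorph_hopfProj α β).localInverseAt z).trans (chartAt CTwo z) := by
  obtain ⟨q, rfl⟩ := he
  exact ⟨_, rfl⟩

/-- The changes of charts of `H_{α,β}` are locally given by powers of `(z₁, z₂) ↦ (α z₁, β z₂)`. -/
theorem hopfSurface_transition {e e' : OpenPartialHomeomorph (HopfSurface α β) CTwo}
    (he : e ∈ atlas CTwo (HopfSurface α β)) (he' : e' ∈ atlas CTwo (HopfSurface α β))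
    {x₀ : CTwo} (hx₀ : x₀ ∈ (e.symm.trans e').source) :
    ∃ n : ℤ, ∀ᶠ x in 𝓝 x₀, e' (e.symm x) = !₂[α ^ n * x 0, β ^ n * x 1] := by
  have hopen := (e.symm.trans e').open_source
  have hcont := (e.symm.trans e').continuousOn
  obtain ⟨z, rfl⟩ := mem_atlas_hopfSurface α β he
  obtain ⟨z', rfl⟩ := mem_atlas_hopfSurface α β he'
  set π := isLocalHomeomorph_hopfProj α β with hπ
  set S := (((π.localInverseAt z).trans (chartAt CTwo z)).symm.trans
    ((π.localInverseAt z').trans (chartAt CTwo z'))).source with hS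
  have hlift : ∀ x ∈ S, ∃ (hx : x ∈ (puncturedCTwo : Set CTwo)) (w : puncturedCTwo),
      w ∈ (π.localInverseAt z').target ∧ hopfProj α β w = hopfProj α β ⟨x, hx⟩ ∧
      ((π.localInverseAt z').trans (chartAt CTwo z'))
        (((π.localInverseAt z).trans (chartAt CTwo z)).symm x) = w.1 := by
    intro x hx
    simp only [hS, OpenPartialHomeomorph.trans_source, OpenPartialHomeomorph.symm_source,
      OpenPartialHomeomorph.trans_target, Set.mem_inter_iff, Set.mem_preimage] at hx
    have hxp : x ∈ (puncturedCTwo : Set CTwo) := by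
      rw [← chartAt_puncturedCTwo_target z]; exact hx.1.1
    have hsymm : ((π.localInverseAt z).trans (chartAt CTwo z)).symm x
        = hopfProj α β ⟨x, hxp⟩ := by
      have : (chartAt CTwo z).symm x = ⟨x, hxp⟩ :=
        Subtype.ext (chartAt_puncturedCTwo_symm_apply z hxp)
      rw [OpenPartialHomeomorph.coe_trans_symm, Function.comp_apply, this, π.localInverseAt_symm]
    rw [hsymm] at hx ⊢
    refine ⟨hxp, π.localInverseAt z' (hopfProj α β ⟨x, hxp⟩),
      (π.localInverseAt z').map_source hx.2.1, π.apply_localInverseAt_of_mem hx.2.1, rfl⟩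
  obtain ⟨hx₀p, w₀, hw₀, hw₀x, hw₀e⟩ := hlift x₀ hx₀
  obtain ⟨γ, hγ⟩ : w₀ ∈ MulAction.orbit (HopfGroup α β) (⟨x₀, hx₀p⟩ : puncturedCTwo) :=
    Quotient.exact hw₀x
  obtain ⟨n, -, hn⟩ := hopfGroup_smul α β γ
  refine ⟨n, ?_⟩
  -- near `x₀`, the translate by `γ` stays in the domain where the projection is injective
  have hγt : ∀ᶠ x : puncturedCTwo in 𝓝 ⟨x₀, hx₀p⟩, γ • x ∈ (π.localInverseAt z').target := by
    have hc : ContinuousAt (fun x : puncturedCTwo ↦ γ • x) ⟨x₀, hx₀p⟩ :=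
      (continuous_const_smul γ).continuousAt
    exact hc.eventually_mem ((π.localInverseAt z').open_target.mem_nhds (by
      rw [show γ • (⟨x₀, hx₀p⟩ : puncturedCTwo) = w₀ from hγ]; exact hw₀))
  rw [(puncturedCTwo.isOpenEmbedding').map_nhds_eq ⟨x₀, hx₀p⟩ |>.symm]
  rw [Filter.eventually_map]
  have hSn : ∀ᶠ x : puncturedCTwo in 𝓝 ⟨x₀, hx₀p⟩, x.1 ∈ S :=
    continuous_subtype_val.continuousAt.eventually_mem (hopen.mem_nhds hx₀)
  filter_upwards [hγt, hSn] with x hx hxS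
  obtain ⟨hxp, w, hw, hwx, hwe⟩ := hlift x.1 hxS
  rw [← hn x, hwe]
  congr 1
  refine π.injOn_localInverseAt_target hw hx ?_
  rw [hwx]
  exact (Quotient.sound (MulAction.mem_orbit x γ)).symm

theorem contDiff_diag {𝕜 : Type*} [RCLike 𝕜] [NormedAlgebra 𝕜 ℂ] (a b : ℂ) (n : ℕ∞ω) :
    ContDiff 𝕜 n (fun x : CTwo ↦ (!₂[a * x 0, b * x 1] : CTwo)) := by
  rw [contDiff_piLp]
  intro i
  have h : ∀ j : Fin 2, ContDiff 𝕜 n (fun x : CTwo ↦ x j) := fun j ↦ contDiff_piLp_apply 2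
  fin_cases i
  · exact contDiff_const.mul (h 0)
  · exact contDiff_const.mul (h 1)

theorem isManifold_hopfSurface {𝕜 : Type*} [RCLike 𝕜] [NormedAlgebra 𝕜 ℂ] (n : ℕ∞ω) :
    IsManifold 𝓘(𝕜, CTwo) n (HopfSurface α β) := by
  refine isManifold_of_contDiffOn _ _ _ fun e e' he he' x hx ↦ ?_
  simp only [modelWithCornersSelf_coe_symm, Set.preimage_id, Set.mem_inter_iff] at hx
  obtain ⟨k, hk⟩ := hopfSurface_transition α β he he' (x₀ := x) hx.1
  refine ContDiffAt.contDiffWithinAt ?_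
  exact (contDiff_diag (𝕜 := 𝕜) (α ^ k) (β ^ k) n).contDiffAt.congr_of_eventuallyEq hk

instance : IsManifold 𝓘(ℂ, CTwo) ω (HopfSurface α β) := isManifold_hopfSurface α β ω

instance : IsManifold 𝓘(ℝ, CTwo) ∞ (HopfSurface α β) := isManifold_hopfSurface α β ∞

/-! ### The diffeomorphism with `S¹ × S³` and the frame -/

/-- The map `F_{α,β}`, `(θ, (ξ₁, ξ₂)) ↦ [e^{θ log α / 2π} ξ₁, e^{θ log β / 2π} ξ₂] ∈ H_{α,β}`,
which is `2π`-periodic in `θ` and induces the diffeomorphism `S¹ × S³ ≅ H_{α,β}`. -/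
def hopfParam (θ : ℝ) (ξ : SThree) : HopfSurface α β :=
  hopfProj α β ⟨hopfF α β (θ, ξ), hopfF_ne_zero α β θ ξ⟩

/-- The differential of `F_{α,β}` at `(θ, ξ)`, on vectors of `T_θ(S¹) × T_ξ(S³) ⊆ ℝ × ℂ²`. -/
def hopfParamDiff (θ : ℝ) (ξ : SThree) (v : ℝ × CTwo) :
    TangentSpace 𝓘(ℝ, CTwo) (hopfParam α β θ ξ) :=
  mfderiv 𝓘(ℝ, CTwo) 𝓘(ℝ, CTwo) (hopfProj α β) ⟨hopfF α β (θ, ξ), hopfF_ne_zero α β θ ξ⟩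
    (show CTwo from fderiv ℝ (hopfF α β) (θ, (ξ : CTwo)) v)

/-- The vector `e₂ = iξ = (iξ₁, iξ₂)` at the point `(θ, ξ)` of `S¹ × S³`. -/
def frameTwo (ξ : SThree) : ℝ × CTwo :=
  (0, !₂[Complex.I * ξ.1 0, Complex.I * ξ.1 1])

/-- The vector `e₃ = jξ = (-ξ̄₂, ξ̄₁)` at the point `(θ, ξ)` of `S¹ × S³`. -/
def frameThree (ξ : SThree) : ℝ × CTwo :=
  (0, !₂[-(starRingEnd ℂ) (ξ.1 1), (starRingEnd ℂ) (ξ.1 0)])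

/-- `(e₂, e₃)`, transferred to `H_{α,β}` by `F_{α,β}`. -/
def hopfFrame (θ : ℝ) (ξ : SThree) : Fin 2 → TangentSpace 𝓘(ℝ, CTwo) (hopfParam α β θ ξ) :=
  ![hopfParamDiff α β θ ξ (frameTwo ξ), hopfParamDiff α β θ ξ (frameThree ξ)]

/-- `g` is the Hermitian metric on `H_{α,β} ≅ S¹ × S³` whose matrix in the complex basis `(e₂, e₃)`
is `diag(k(θ), 1)` at every point `(θ, ξ)`. -/
def HasMatrixDiag (k : ℝ → ℝ) (g : SmoothMetric CTwo (HopfSurface α β)) : Prop :=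
  IsHermitianMetric g ∧ ∀ (θ : ℝ) (ξ : SThree),
    (Matrix.of fun i j ↦ hermitianForm g (hopfParam α β θ ξ)
      (hopfFrame α β θ ξ i) (hopfFrame α β θ ξ j)) = !![(k θ : ℂ), 0; 0, 1]

end HopfSurfaces

/-! ### Radial Hermitian forms on `ℂ²` -/

noncomputable section RadialForms

/-! Everything is computed on the cover ℂ² ∖ 0. Put s = ‖x‖² and κ(t) = k(πt / log‖α‖). Since ‖α‖ =
‖β‖, the linear map F(θ, ·) scales all norms by the same factor, so log s = θ log‖α‖ / π on F(θ, S³)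
and κ(log s) = k(θ). The frame lifts to ix and to a unit complex multiple of jx = (-x̄₂, x̄₁). The
metric is therefore forced to be G = `logMetric κ`: the form s⁻¹ Re⟪u, v⟫ with its restriction to
the complex line of x multiplied by κ(log s). The generator of the deck group shifts log s by 2
log‖α‖, a period of κ, so G descends. Inverse charts of the Hopf surface are restrictions of the
projection, so the descended metric reads G in every chart (`chartBilin_hopfInner`).

The fundamental form of `radialBilin ψ χ` is closed once χ = ψ' (`radialBilin_closed`): up to a
constant it is then i∂∂̄P(s) with P' = ψ. For e^{-Ψ(log s)} G this condition reads Ψ' = -κ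
(`exp_smul_logMetric_closed`), which gives l.c.K. with Lee form η = -κ(log s) d(log s) = -2 G(x, ·).
As κ > 0, the primitive Ψ is not periodic, and the potentials are only local. Every Kähler factor
has differential η, because wedging 1-forms with the fundamental form Ω is injective in real
dimension 4 (`eq_zero_of_wedge_logMetric`).

Finally, η is closed and dual to -2 times the Euler field x, so ∇η = -L_x G. Scaling x changes G
only through the argument of κ, hence ∇η is κ'(log s) times a tensor that is nonzero at every point
(`covariantDeriv_logLeeForm`). It vanishes exactly when κ, equivalently k, is constant. -/

/-- The real part of the standard Hermitian product of `ℂ²`. -/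
def reProd : CTwo →L[ℝ] CTwo →L[ℝ] ℝ :=
  (LinearMap.mk₂ ℝ
    (fun u v : CTwo ↦ (u 0).re * (v 0).re + (u 0).im * (v 0).im
      + ((u 1).re * (v 1).re + (u 1).im * (v 1).im))
    (by intros; simp; ring) (by intros; simp; ring) (by intros; simp; ring)
    (by intros; simp; ring)).toContinuousBilinearMap

/-- The imaginary part of the standard Hermitian product of `ℂ²`, linear in the second variable. -/
def imProd : CTwo →L[ℝ] CTwo →L[ℝ] ℝ :=
  (LinearMap.mk₂ ℝ
    (fun u v : CTwo ↦ (u 0).re * (v 0).im - (u 0).im * (v 0).re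
      + ((u 1).re * (v 1).im - (u 1).im * (v 1).re))
    (by intros; simp; ring) (by intros; simp; ring) (by intros; simp; ring)
    (by intros; simp; ring)).toContinuousBilinearMap

theorem reProd_apply (u v : CTwo) : reProd u v = (u 0).re * (v 0).re + (u 0).im * (v 0).im
      + ((u 1).re * (v 1).re + (u 1).im * (v 1).im) := rfl

theorem imProd_apply (u v : CTwo) : imProd u v = (u 0).re * (v 0).im - (u 0).im * (v 0).re
      + ((u 1).re * (v 1).im - (u 1).im * (v 1).re) := rfl

theorem reProd_comm (u v : CTwo) : reProd u v = reProd v u := by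
  simp only [reProd_apply]; ring

theorem imProd_swap (u v : CTwo) : imProd u v = -imProd v u := by
  simp only [imProd_apply]; ring

theorem imProd_self (u : CTwo) : imProd u u = 0 := by
  simp only [imProd_apply]; ring

theorem reProd_I_smul (u v : CTwo) : reProd (Complex.I • u) v = imProd u v := by
  simp [reProd_apply, imProd_apply]; ring

theorem imProd_I_smul (u v : CTwo) : imProd (Complex.I • u) v = -reProd u v := by
  simp [reProd_apply, imProd_apply]; ring

theorem reProd_I_smul_right (u v : CTwo) : reProd u (Complex.I • v) = -imProd u v := by
  simp [reProd_apply, imProd_apply]; ring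

theorem imProd_I_smul_right (u v : CTwo) : imProd u (Complex.I • v) = reProd u v := by
  simp [reProd_apply, imProd_apply]

theorem reProd_self (u : CTwo) : reProd u u = ‖u‖ ^ 2 := by
  rw [EuclideanSpace.norm_sq_eq, Fin.sum_univ_two, ← Complex.normSq_eq_norm_sq,
    ← Complex.normSq_eq_norm_sq, Complex.normSq_apply, Complex.normSq_apply, reProd_apply]

theorem reProd_self_pos {u : CTwo} (hu : u ≠ 0) : 0 < reProd u u := by
  rw [reProd_self]; positivity

/-- Lagrange's identity: the two sides differ by |x₁u₂ - x₂u₁|², whose real and imaginary parts are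
the squares supplied below. -/
theorem sq_reProd_add_sq_imProd_le (x u : CTwo) :
    reProd x u ^ 2 + imProd x u ^ 2 ≤ reProd x x * reProd u u := by
  simp only [reProd_apply, imProd_apply]
  nlinarith [sq_nonneg ((x 0).re * (u 1).re - (x 0).im * (u 1).im
      - ((x 1).re * (u 0).re - (x 1).im * (u 0).im)),
    sq_nonneg ((x 0).re * (u 1).im + (x 0).im * (u 1).re
      - ((x 1).re * (u 0).im + (x 1).im * (u 0).re))]

/-- The form `ψ(‖x‖²) Re⟪u, v⟫ + χ(‖x‖²) Re(⟪x, u⟫ ⟪v, x⟫)` at the point `x`. -/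
def radialBilin (ψ χ : ℝ → ℝ) (x : CTwo) : CTwo →L[ℝ] CTwo →L[ℝ] ℝ :=
  ψ (reProd x x) • reProd + χ (reProd x x) •
    ((reProd x).smulRight (reProd x) + (imProd x).smulRight (imProd x))

theorem radialBilin_apply (ψ χ : ℝ → ℝ) (x u v : CTwo) :
    radialBilin ψ χ x u v = ψ (reProd x x) * reProd u v
      + χ (reProd x x) * (reProd x u * reProd x v + imProd x u * imProd x v) := rfl

theorem radialBilin_comm (ψ χ : ℝ → ℝ) (x u v : CTwo) :
    radialBilin ψ χ x u v = radialBilin ψ χ x v u := by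
  rw [radialBilin_apply, radialBilin_apply, reProd_comm u v]; ring

theorem radialBilin_I_smul_I_smul (ψ χ : ℝ → ℝ) (x u v : CTwo) :
    radialBilin ψ χ x (Complex.I • u) (Complex.I • v) = radialBilin ψ χ x u v := by
  simp only [radialBilin_apply, reProd_I_smul_right, imProd_I_smul_right, imProd_I_smul]
  ring

theorem contDiff_reProd_self : ContDiff ℝ ∞ fun x : CTwo ↦ reProd x x :=
  reProd.contDiff.clm_apply contDiff_id

theorem contDiffOn_radialBilin {ψ χ : ℝ → ℝ} (hψ : ContDiffOn ℝ ∞ ψ (Set.Ioi 0))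
    (hχ : ContDiffOn ℝ ∞ χ (Set.Ioi 0)) : ContDiffOn ℝ ∞ (radialBilin ψ χ) {0}ᶜ := by
  have hs : ContDiffOn ℝ ∞ (fun x : CTwo ↦ reProd x x) {0}ᶜ := contDiff_reProd_self.contDiffOn
  have hm : Set.MapsTo (fun x : CTwo ↦ reProd x x) {0}ᶜ (Set.Ioi 0) :=
    fun x hx ↦ reProd_self_pos hx
  have hψs : ContDiffOn ℝ ∞ (fun x : CTwo ↦ ψ (reProd x x)) {0}ᶜ := hψ.comp hs hm
  have hχs : ContDiffOn ℝ ∞ (fun x : CTwo ↦ χ (reProd x x)) {0}ᶜ := hχ.comp hs hm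
  have hr : ∀ u, ContDiffOn ℝ ∞ (fun x : CTwo ↦ reProd x u) {0}ᶜ := fun u ↦
    (reProd.contDiff.clm_apply contDiff_const).contDiffOn
  have hi : ∀ u, ContDiffOn ℝ ∞ (fun x : CTwo ↦ imProd x u) {0}ᶜ := fun u ↦
    (imProd.contDiff.clm_apply contDiff_const).contDiffOn
  rw [contDiffOn_clm_apply]
  intro u
  rw [contDiffOn_clm_apply]
  intro v
  simp only [radialBilin_apply]
  exact (hψs.mul contDiffOn_const).add
    (hχs.mul (((hr u).mul (hr v)).add ((hi u).mul (hi v))))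

theorem differentiableAt_radialBilin {ψ χ : ℝ → ℝ} (hψ : ContDiffOn ℝ ∞ ψ (Set.Ioi 0))
    (hχ : ContDiffOn ℝ ∞ χ (Set.Ioi 0)) {x : CTwo} (hx : x ≠ 0) :
    DifferentiableAt ℝ (radialBilin ψ χ) x :=
  ((contDiffOn_radialBilin hψ hχ).contDiffAt (isOpen_compl_singleton.mem_nhds hx)).differentiableAt
    (by simp)

/-! ### Derivatives of radial forms and closed fundamental forms -/

/-- The derivatives of a field of bilinear forms are the derivatives of its values along lines. -/
theorem fderiv_apply_apply_eq {G : CTwo → CTwo →L[ℝ] CTwo →L[ℝ] ℝ} {x w u v : CTwo} {d : ℝ}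
    (hG : DifferentiableAt ℝ G x) (h : HasDerivAt (fun t : ℝ ↦ G (x + t • w) u v) d 0) :
    fderiv ℝ G x w u v = d := by
  have h1 : HasDerivAt (fun t : ℝ ↦ x + t • w) w 0 := by
    simpa using ((hasDerivAt_id (0 : ℝ)).smul_const w).const_add x
  have h2 : HasFDerivAt G (fderiv ℝ G x) (x + (0 : ℝ) • w) := by simpa using hG.hasFDerivAt
  have h3 : HasDerivAt (fun t : ℝ ↦ G (x + t • w)) (fderiv ℝ G x w) 0 :=
    HasFDerivAt.comp_hasDerivAt (l := G) (f := fun t : ℝ ↦ x + t • w) 0 h2 h1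
  have h4 := (h3.clm_apply (hasDerivAt_const (0 : ℝ) u)).clm_apply (hasDerivAt_const (0 : ℝ) v)
  simpa using h4.unique h

theorem hasDerivAt_line (B : CTwo →L[ℝ] CTwo →L[ℝ] ℝ) (x w u : CTwo) :
    HasDerivAt (fun t : ℝ ↦ B (x + t • w) u) (B w u) 0 := by
  simpa using ((hasDerivAt_id (0 : ℝ)).smul_const (B w u)).const_add (B x u)

theorem hasDerivAt_reProd_self_line (x w : CTwo) :
    HasDerivAt (fun t : ℝ ↦ reProd (x + t • w) (x + t • w)) (2 * reProd x w) 0 := by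
  have h : (fun t : ℝ ↦ reProd (x + t • w) (x + t • w))
      = fun t ↦ reProd x x + t * (2 * reProd x w) + t ^ 2 * reProd w w := by
    funext t
    simp only [map_add, map_smul, add_apply, smul_apply,
      smul_eq_mul, reProd_comm w x]
    ring
  rw [h]
  have h1 := ((hasDerivAt_id (0 : ℝ)).mul_const (2 * reProd x w)).const_add (reProd x x)
  have h2 := (hasDerivAt_pow 2 (0 : ℝ)).mul_const (reProd w w)
  have h3 := h1.fun_add h2
  simp only [id_eq] at h3
  exact h3.congr_deriv (by norm_num)

theorem fderiv_radialBilin {ψ χ : ℝ → ℝ} {ψ' χ' : ℝ} {x : CTwo}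
    (hG : DifferentiableAt ℝ (radialBilin ψ χ) x) (hψ : HasDerivAt ψ ψ' (reProd x x))
    (hχ : HasDerivAt χ χ' (reProd x x)) (w u v : CTwo) :
    fderiv ℝ (radialBilin ψ χ) x w u v =
      2 * reProd x w * (ψ' * reProd u v
        + χ' * (reProd x u * reProd x v + imProd x u * imProd x v))
      + χ (reProd x x) * (reProd w u * reProd x v + reProd x u * reProd w v
        + (imProd w u * imProd x v + imProd x u * imProd w v)) := by
  refine fderiv_apply_apply_eq hG ?_
  simp only [radialBilin_apply]
  have hs := hasDerivAt_reProd_self_line x w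
  have e0 : reProd (x + (0 : ℝ) • w) (x + (0 : ℝ) • w) = reProd x x := by simp
  have h1 : HasDerivAt (fun t : ℝ ↦ ψ (reProd (x + t • w) (x + t • w))) _ 0 :=
    HasDerivAt.comp (h₂ := ψ) (h := fun t : ℝ ↦ reProd (x + t • w) (x + t • w)) 0
      (by simpa using hψ) hs
  have h2 : HasDerivAt (fun t : ℝ ↦ χ (reProd (x + t • w) (x + t • w))) _ 0 :=
    HasDerivAt.comp (h₂ := χ) (h := fun t : ℝ ↦ reProd (x + t • w) (x + t • w)) 0
      (by simpa using hχ) hs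
  have h3 := (h1.mul_const (reProd u v)).add (h2.mul
    (((hasDerivAt_line reProd x w u).mul (hasDerivAt_line reProd x w v)).add
      ((hasDerivAt_line imProd x w u).mul (hasDerivAt_line imProd x w v))))
  refine h3.congr_deriv ?_
  simp only [zero_smul, add_zero, Pi.add_apply, Pi.mul_apply]
  ring

/-- Multiplication by `i` on `ℂ²`, as a real linear map. -/
def mulI : CTwo →L[ℝ] CTwo := (Complex.I • ContinuousLinearMap.id ℂ CTwo).restrictScalars ℝ

theorem mulI_apply (u : CTwo) : mulI u = Complex.I • u := rfl

theorem fderiv_comp_mulI {G : CTwo → CTwo →L[ℝ] CTwo →L[ℝ] ℝ} {x : CTwo}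
    (hG : DifferentiableAt ℝ G x) (w u v : CTwo) :
    fderiv ℝ (fun y ↦ (G y).comp mulI) x w u v = fderiv ℝ G x w (Complex.I • u) v := by
  rw [fderiv_clm_comp hG (differentiableAt_const _)]
  simp [mulI_apply]

/-- The form `Ω(u, v) = B(iu, v)` is closed for `B = radialBilin ψ χ` if `ψ' = χ`. -/
theorem radialBilin_closed {ψ χ : ℝ → ℝ} {x : CTwo}
    (hG : DifferentiableAt ℝ (radialBilin ψ χ) x)
    (hψ : HasDerivAt ψ (χ (reProd x x)) (reProd x x))
    (hχ : DifferentiableAt ℝ χ (reProd x x)) (u v w : CTwo) :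
    fderiv ℝ (fun y ↦ (radialBilin ψ χ y).comp mulI) x u v w
      - fderiv ℝ (fun y ↦ (radialBilin ψ χ y).comp mulI) x v u w
      + fderiv ℝ (fun y ↦ (radialBilin ψ χ y).comp mulI) x w u v = 0 := by
  simp only [fderiv_comp_mulI hG, fderiv_radialBilin hG hψ hχ.hasDerivAt, reProd_I_smul,
    reProd_I_smul_right, imProd_I_smul_right]
  -- The terms in χ' cancel by alternation alone; those coming from ψ' cancel against those in χ,
  -- which is where ψ' = χ enters.
  rw [imProd_swap v u, imProd_swap w u, imProd_swap w v, reProd_comm v u, reProd_comm w u,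
    reProd_comm w v]
  ring

/-! ### The metric with logarithmic weight -/

/-- The metric `‖x‖⁻² Re⟪u, v⟫ + (κ(log ‖x‖²) - 1) ‖x‖⁻⁴ Re(⟪x, u⟫ ⟪v, x⟫)` on `ℂ² ∖ 0`. -/
def logMetric (κ : ℝ → ℝ) : CTwo → CTwo →L[ℝ] CTwo →L[ℝ] ℝ :=
  radialBilin (fun s ↦ s⁻¹) (fun s ↦ (κ (Real.log s) - 1) / s ^ 2)

theorem logMetric_apply (κ : ℝ → ℝ) (x u v : CTwo) :
    logMetric κ x u v = (reProd x x)⁻¹ * reProd u v + (κ (Real.log (reProd x x)) - 1)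
      / reProd x x ^ 2 * (reProd x u * reProd x v + imProd x u * imProd x v) := rfl

variable {κ : ℝ → ℝ}

theorem contDiffOn_inv_Ioi : ContDiffOn ℝ ∞ (fun s : ℝ ↦ s⁻¹) (Set.Ioi 0) :=
  fun _ hs ↦ (contDiffAt_inv ℝ (Set.mem_Ioi.mp hs).ne').contDiffWithinAt

theorem contDiffOn_comp_log {Ψ : ℝ → ℝ} (hΨ : ContDiff ℝ ∞ Ψ) :
    ContDiffOn ℝ ∞ (fun s ↦ Ψ (Real.log s)) (Set.Ioi 0) :=
  hΨ.comp_contDiffOn fun _ hs ↦ (Real.contDiffAt_log.mpr (Set.mem_Ioi.mp hs).ne').contDiffWithinAt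

theorem contDiffOn_logMetric_coeff (hκ : ContDiff ℝ ∞ κ) :
    ContDiffOn ℝ ∞ (fun s ↦ (κ (Real.log s) - 1) / s ^ 2) (Set.Ioi 0) :=
  ((contDiffOn_comp_log hκ).sub contDiffOn_const).div (by fun_prop)
    fun s hs ↦ (pow_pos (Set.mem_Ioi.mp hs) 2).ne'

theorem contDiffOn_logMetric (hκ : ContDiff ℝ ∞ κ) : ContDiffOn ℝ ∞ (logMetric κ) {0}ᶜ :=
  contDiffOn_radialBilin contDiffOn_inv_Ioi (contDiffOn_logMetric_coeff hκ)

theorem differentiableAt_logMetric (hκ : ContDiff ℝ ∞ κ) {x : CTwo} (hx : x ≠ 0) :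
    DifferentiableAt ℝ (logMetric κ) x :=
  differentiableAt_radialBilin contDiffOn_inv_Ioi (contDiffOn_logMetric_coeff hκ) hx

/-- Cauchy–Schwarz bounds the negative term (m - 1)|⟪x, u⟫|². Taking m = min 1 κ yields both
positivity and boundedness of the unit balls. -/
theorem le_logMetric_self {m : ℝ} {x : CTwo} (hx : x ≠ 0) (hm1 : m ≤ 1)
    (hm : m ≤ κ (Real.log (reProd x x))) (u : CTwo) :
    m * reProd u u / reProd x x ≤ logMetric κ x u u := by
  have hs := reProd_self_pos hx
  have hcs := sq_reProd_add_sq_imProd_le x u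
  have e : logMetric κ x u u = (reProd x x * reProd u u + (κ (Real.log (reProd x x)) - 1) *
      (reProd x u ^ 2 + imProd x u ^ 2)) / reProd x x ^ 2 := by
    rw [logMetric_apply]; field_simp
  have e' : m * reProd u u / reProd x x = (m * (reProd x x * reProd u u)) / reProd x x ^ 2 := by
    field_simp
  rw [e, e']
  gcongr
  have : 0 ≤ reProd x u ^ 2 + imProd x u ^ 2 := by positivity
  nlinarith

theorem logMetric_self_pos {x : CTwo} (hx : x ≠ 0) (hκ : 0 < κ (Real.log (reProd x x)))
    {u : CTwo} (hu : u ≠ 0) : 0 < logMetric κ x u u := by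
  refine lt_of_lt_of_le ?_ (le_logMetric_self hx (min_le_left 1 (κ (Real.log (reProd x x))))
    (min_le_right _ _) u)
  have := reProd_self_pos hx
  have := reProd_self_pos hu
  have : 0 < min 1 (κ (Real.log (reProd x x))) := lt_min one_pos hκ
  positivity

theorem isVonNBounded_logMetric {x : CTwo} (hx : x ≠ 0) (hκ : 0 < κ (Real.log (reProd x x))) :
    Bornology.IsVonNBounded ℝ {v : CTwo | logMetric κ x v v < 1} := by
  rw [NormedSpace.isVonNBounded_iff, isBounded_iff_forall_norm_le]
  have hm : 0 < min 1 (κ (Real.log (reProd x x))) := lt_min one_pos hκ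
  have hs := reProd_self_pos hx
  refine ⟨√(reProd x x / min 1 (κ (Real.log (reProd x x)))), fun v hv ↦ Real.le_sqrt_of_sq_le ?_⟩
  have h := (le_logMetric_self hx (min_le_left 1 (κ (Real.log (reProd x x))))
    (min_le_right _ _) v).trans_lt hv
  rw [reProd_self v, div_lt_one hs] at h
  rw [le_div_iff₀ hm]
  linarith

/-! ### Invariance under the deck transformations -/

/-- A diagonal complex linear map of `ℂ²`, as a real linear map. -/
def diagCLM (a b : ℂ) : CTwo →L[ℝ] CTwo :=
  LinearMap.toContinuousLinearMap
    { toFun := fun x ↦ !₂[a * x 0, b * x 1]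
      map_add' := by
        intro x y; ext i; fin_cases i <;> simp [mul_add]
      map_smul' := by
        intro c x; ext i; fin_cases i <;> simp [mul_left_comm] }

theorem diagCLM_apply (a b : ℂ) (x : CTwo) : diagCLM a b x = !₂[a * x 0, b * x 1] := rfl

theorem diagCLM_I_smul (a b : ℂ) (x : CTwo) :
    diagCLM a b (Complex.I • x) = Complex.I • diagCLM a b x := by
  ext i; fin_cases i <;> simp [diagCLM_apply, mul_left_comm]

theorem diagCLM_surjective {a b : ℂ} (ha : a ≠ 0) (hb : b ≠ 0) :
    Function.Surjective (diagCLM a b) := by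
  intro y
  refine ⟨!₂[a⁻¹ * y 0, b⁻¹ * y 1], ?_⟩
  ext i; fin_cases i <;> simp [diagCLM_apply, ha, hb]

theorem reProd_diagCLM {a b : ℂ} (hab : ‖a‖ = ‖b‖) (u v : CTwo) :
    reProd (diagCLM a b u) (diagCLM a b v) = ‖a‖ ^ 2 * reProd u v := by
  have ha := Complex.normSq_eq_norm_sq a
  have hb := Complex.normSq_eq_norm_sq b
  rw [← hab] at hb
  rw [Complex.normSq_apply] at ha hb
  simp only [reProd_apply, diagCLM_apply]
  simp
  linear_combination ((u 0).re * (v 0).re + (u 0).im * (v 0).im) * ha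
    + ((u 1).re * (v 1).re + (u 1).im * (v 1).im) * hb

theorem imProd_diagCLM {a b : ℂ} (hab : ‖a‖ = ‖b‖) (u v : CTwo) :
    imProd (diagCLM a b u) (diagCLM a b v) = ‖a‖ ^ 2 * imProd u v := by
  rw [← reProd_I_smul, ← reProd_I_smul, ← diagCLM_I_smul, reProd_diagCLM hab]

/-- Both parts of the Hermitian product scale by ‖a‖², and the coefficients compensate, so only the
argument of κ changes, by 2 log‖a‖. -/
theorem logMetric_diagCLM {a b : ℂ} (hab : ‖a‖ = ‖b‖) (ha : a ≠ 0) {x : CTwo} (hx : x ≠ 0)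
    (hκ : ∀ t, κ (t + 2 * Real.log ‖a‖) = κ t) (u v : CTwo) :
    logMetric κ (diagCLM a b x) (diagCLM a b u) (diagCLM a b v) = logMetric κ x u v := by
  have hs := reProd_self_pos hx
  have hn : 0 < ‖a‖ := norm_pos_iff.mpr ha
  have hlog : Real.log (‖a‖ ^ 2 * reProd x x) = Real.log (reProd x x) + 2 * Real.log ‖a‖ := by
    rw [Real.log_mul (by positivity) hs.ne', Real.log_pow]; push_cast; ring
  simp only [logMetric_apply, reProd_diagCLM hab, imProd_diagCLM hab, hlog, hκ]
  field_simp

/-! ### The Lee form on the cover -/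

/-- The form `v ↦ -2 G(x, v)` for `G = logMetric κ`. -/
def logLeeForm (κ : ℝ → ℝ) (x : CTwo) : CTwo →L[ℝ] ℝ := (-2 : ℝ) • logMetric κ x x

theorem logLeeForm_apply {x : CTwo} (hx : x ≠ 0) (v : CTwo) :
    logLeeForm κ x v = -κ (Real.log (reProd x x)) * (2 * reProd x v / reProd x x) := by
  have hs := (reProd_self_pos hx).ne'
  simp only [logLeeForm, smul_apply, logMetric_apply, imProd_self, smul_eq_mul]
  field_simp
  ring

theorem hasFDerivAt_log_weight {Ψ : ℝ → ℝ} {x : CTwo} (hx : x ≠ 0)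
    (hΨ : HasDerivAt Ψ (-κ (Real.log (reProd x x))) (Real.log (reProd x x))) :
    HasFDerivAt (fun y : CTwo ↦ Ψ (Real.log (reProd y y))) (logLeeForm κ x) x := by
  have hs := reProd_self_pos hx
  have h1 : DifferentiableAt ℝ (fun y : CTwo ↦ reProd y y) x :=
    (contDiff_reProd_self.differentiable (by simp)) x
  have h2 : HasFDerivAt (fun y : CTwo ↦ reProd y y) ((2 : ℝ) • reProd x) x := by
    convert h1.hasFDerivAt using 1
    ext w
    have h3 : HasDerivAt (fun t : ℝ ↦ x + t • w) w 0 := by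
      simpa using ((hasDerivAt_id (0 : ℝ)).smul_const w).const_add x
    have h4 : HasFDerivAt (fun y : CTwo ↦ reProd y y) (fderiv ℝ (fun y : CTwo ↦ reProd y y) x)
      (x + (0 : ℝ) • w) := by simpa using h1.hasFDerivAt
    exact (hasDerivAt_reProd_self_line x w).unique 
      (HasFDerivAt.comp_hasDerivAt (l := fun y : CTwo ↦ reProd y y) (f := fun t : ℝ ↦ x + t • w)
        0 h4 h3)
  have h5 := hΨ.comp_hasFDerivAt (f := fun y : CTwo ↦ Real.log (reProd y y)) x (h2.log hs.ne')
  refine h5.congr_fderiv ?_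
  ext v
  rw [logLeeForm_apply hx]
  simp only [smul_apply, smul_eq_mul]
  ring

/-- `e^{-Ψ(log ‖x‖²)}` times the fundamental form of `logMetric κ` is closed if `Ψ' = -κ`. -/
theorem exp_smul_logMetric_closed (hκ : ContDiff ℝ ∞ κ) {Ψ : ℝ → ℝ}
    (hΨ : ∀ t, HasDerivAt Ψ (-κ t) t) (hΨ' : ContDiff ℝ ∞ Ψ) {x : CTwo} (hx : x ≠ 0)
    (u v w : CTwo) :
    let Ω := fun y : CTwo ↦ Real.exp (-Ψ (Real.log (reProd y y))) • (logMetric κ y).comp mulI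
    fderiv ℝ Ω x u v w - fderiv ℝ Ω x v u w + fderiv ℝ Ω x w u v = 0 := by
  intro Ω
  have hs := (reProd_self_pos hx).ne'
  set ψ : ℝ → ℝ := fun s ↦ Real.exp (-Ψ (Real.log s)) * s⁻¹ with hψ
  set χ : ℝ → ℝ := fun s ↦ Real.exp (-Ψ (Real.log s)) * ((κ (Real.log s) - 1) / s ^ 2) with hχ
  have hΩ : Ω = fun y ↦ (radialBilin ψ χ y).comp mulI := by
    funext y
    ext u v
    simp only [Ω, smul_apply, ContinuousLinearMap.comp_apply, logMetric_apply,
      radialBilin_apply, smul_eq_mul, hψ, hχ]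
    ring
  have hexp : ContDiffOn ℝ ∞ (fun s ↦ Real.exp (-Ψ (Real.log s))) (Set.Ioi 0) :=
    (contDiffOn_comp_log hΨ').neg.exp
  have hψs : ContDiffOn ℝ ∞ ψ (Set.Ioi 0) := hexp.mul contDiffOn_inv_Ioi
  have hχs : ContDiffOn ℝ ∞ χ (Set.Ioi 0) := hexp.mul (contDiffOn_logMetric_coeff hκ)
  rw [hΩ]
  refine radialBilin_closed (differentiableAt_radialBilin hψs hχs hx) ?_
    ((hχs.contDiffAt (Ioi_mem_nhds (reProd_self_pos hx))).differentiableAt (by simp)) u v w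
  -- In (e^{-Ψ(log s)} / s)' = e^{-Ψ(log s)} (κ - 1) / s², the κ comes from the exponent and the -1
  -- from s⁻¹; this is exactly χ.
  have h1 := ((hΨ _).comp _ (Real.hasDerivAt_log hs)).neg.exp
  have h2 := h1.mul (hasDerivAt_inv hs)
  refine h2.congr_deriv ?_
  simp only [hχ, Function.comp_apply, Pi.neg_apply]
  field_simp
  ring

/-! ### The frame x, ix, jx, ijx and injectivity of the wedge with Ω -/

/-- The quaternionic structure `j(x₁, x₂) = (-x̄₂, x̄₁)` of `ℂ²`. -/
def quatJ (x : CTwo) : CTwo := !₂[-(starRingEnd ℂ) (x 1), (starRingEnd ℂ) (x 0)]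

theorem reProd_quatJ (x : CTwo) : reProd x (quatJ x) = 0 := by
  simp [reProd_apply, quatJ]; ring

theorem imProd_quatJ (x : CTwo) : imProd x (quatJ x) = 0 := by
  simp [imProd_apply, quatJ]; ring

theorem reProd_quatJ_self (x : CTwo) : reProd (quatJ x) (quatJ x) = reProd x x := by
  simp [reProd_apply, quatJ]; ring

/-- `x, ix, jx, ijx` span `ℂ²`. -/
theorem reProd_self_smul_eq (x u : CTwo) :
    reProd x x • u = reProd x u • x + imProd x u • (Complex.I • x)
      + reProd (quatJ x) u • quatJ x + imProd (quatJ x) u • (Complex.I • quatJ x) := by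
  ext i
  fin_cases i <;> apply Complex.ext <;> simp [reProd_apply, imProd_apply, quatJ] <;> ring

/-- A one-form whose exterior product with the fundamental form of `logMetric κ` vanishes
is zero. -/
theorem eq_zero_of_wedge_logMetric {x : CTwo} (hx : x ≠ 0) (hκ : 0 < κ (Real.log (reProd x x)))
    (η : CTwo →L[ℝ] ℝ)
    (h : ∀ u v w : CTwo, η u * logMetric κ x (Complex.I • v) w
      - η v * logMetric κ x (Complex.I • u) w + η w * logMetric κ x (Complex.I • u) v = 0) :
    η = 0 := by
  have hs := reProd_self_pos hx
  have c1 : reProd (quatJ x) x = 0 := by rw [reProd_comm, reProd_quatJ]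
  have c2 : imProd (quatJ x) x = 0 := by rw [imProd_swap, imProd_quatJ, neg_zero]
  -- This is G(x, x) = κ(log s), in the unsimplified form in which it appears in `h3` and `h4`.
  have hk : (reProd x x)⁻¹ * reProd x x + (κ (Real.log (reProd x x)) - 1) / reProd x x ^ 2 *
      (reProd x x * reProd x x) = κ (Real.log (reProd x x)) := by field_simp; ring
  -- The complex lines of x and jx are G-orthogonal. Testing a vector of one line against a vector
  -- and its i-multiple in the other leaves a single term, with coefficient of absolute value 1 here
  -- and κ in `h3`, `h4`.
  have h1 : η x = 0 := by
    simpa [logMetric_apply, reProd_I_smul, reProd_I_smul_right, imProd_I_smul,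
      imProd_I_smul_right, reProd_quatJ, imProd_quatJ, reProd_quatJ_self, imProd_self, c1, c2,
      hs.ne'] using h x (quatJ x) (Complex.I • quatJ x)
  have h2 : η (Complex.I • x) = 0 := by
    simpa [logMetric_apply, reProd_I_smul, reProd_I_smul_right, imProd_I_smul,
      imProd_I_smul_right, reProd_quatJ, imProd_quatJ, reProd_quatJ_self, imProd_self, c1, c2,
      hs.ne'] using h (Complex.I • x) (quatJ x) (Complex.I • quatJ x)
  have h3 : η (quatJ x) = 0 := by
    simpa [-inv_mul_cancel₀, hk, hκ.ne', logMetric_apply, reProd_I_smul, reProd_I_smul_right,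
      imProd_I_smul, imProd_I_smul_right, reProd_quatJ, imProd_quatJ, imProd_self, c1, c2]
      using h (quatJ x) x (Complex.I • x)
  have h4 : η (Complex.I • quatJ x) = 0 := by
    simpa [-inv_mul_cancel₀, hk, hκ.ne', logMetric_apply, reProd_I_smul, reProd_I_smul_right,
      imProd_I_smul, imProd_I_smul_right, reProd_quatJ, imProd_quatJ, imProd_self, c1, c2]
      using h (Complex.I • quatJ x) x (Complex.I • x)
  ext u
  have h5 := congrArg η (reProd_self_smul_eq x u)
  simp only [map_add, map_smul, h1, h2, h3, h4, smul_zero, add_zero] at h5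
  simpa [hs.ne'] using h5

/-! ### The covariant derivative of the Lee form on the cover -/

theorem hasDerivAt_logMetric_coeff (hκ : ContDiff ℝ ∞ κ) {s : ℝ} (hs : 0 < s) :
    HasDerivAt (fun s ↦ (κ (Real.log s) - 1) / s ^ 2)
      (deriv κ (Real.log s) / s ^ 3 - 2 * (κ (Real.log s) - 1) / s ^ 3) s := by
  have h1 := ((hκ.differentiable (by simp)) (Real.log s)).hasDerivAt.comp s
    (Real.hasDerivAt_log hs.ne')
  refine ((h1.sub_const 1).fun_div (hasDerivAt_pow 2 s) (by positivity)).congr_deriv ?_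
  simp only [Function.comp_apply]
  field_simp
  push_cast
  ring

/-- `inverse` takes the value 0 at non-invertible maps, so invertibility must be established: G is
injective by positivity, and the dual has the same dimension. -/
theorem logMetric_inverse {x : CTwo} (hx : x ≠ 0) (hκ : 0 < κ (Real.log (reProd x x)))
    (φ : CTwo →L[ℝ] ℝ) : logMetric κ x ((logMetric κ x).inverse φ) = φ := by
  have hinj : Function.Injective (logMetric κ x) := by
    rw [injective_iff_map_eq_zero]
    intro u hu
    by_contra hne
    have := logMetric_self_pos hx hκ hne
    simp [hu] at this
  have hfin : Module.finrank ℝ CTwo = Module.finrank ℝ (CTwo →L[ℝ] ℝ) := by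
    rw [← (LinearMap.toContinuousLinearMap (𝕜 := ℝ) (E := CTwo) (F' := ℝ)).finrank_eq]
    exact (Subspace.dual_finrank_eq (K := ℝ) (V := CTwo)).symm
  let e : CTwo ≃L[ℝ] (CTwo →L[ℝ] ℝ) :=
    (LinearEquiv.ofInjectiveOfFinrankEq (logMetric κ x).toLinearMap hinj
      hfin).toContinuousLinearEquiv
  have he : logMetric κ x = (e : CTwo →L[ℝ] (CTwo →L[ℝ] ℝ)) := by
    ext u v; rfl
  rw [he, ContinuousLinearMap.inverse_equiv]
  exact e.apply_symm_apply φ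

theorem logMetric_christoffel {x : CTwo} (hx : x ≠ 0) (hκ : 0 < κ (Real.log (reProd x x)))
    (u v w : CTwo) : logMetric κ x (christoffel (logMetric κ) x u v) w =
      (fderiv ℝ (logMetric κ) x u v w + fderiv ℝ (logMetric κ) x v u w
        - fderiv ℝ (logMetric κ) x w u v) / 2 := by
  rw [christoffel, logMetric_inverse hx hκ]
  simp only [smul_apply, sub_apply, add_apply, ContinuousLinearMap.flip_apply, smul_eq_mul]
  ring

/-- The covariant derivative of the Lee form of `logMetric κ`. -/
theorem covariantDeriv_logLeeForm (hκ : ContDiff ℝ ∞ κ) {x : CTwo} (hx : x ≠ 0)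
    (hpos : 0 < κ (Real.log (reProd x x))) (u v : CTwo) :
    fderiv ℝ (logLeeForm κ) x u v - logLeeForm κ x (christoffel (logMetric κ) x u v) =
      -2 * deriv κ (Real.log (reProd x x)) / reProd x x ^ 2 *
        (reProd x u * reProd x v + imProd x u * imProd x v) := by
  have hs := reProd_self_pos hx
  have hG := differentiableAt_logMetric hκ hx
  -- In -2 G(x, v) the point x is both base point and argument, hence the additional term G(u, v).
  have hη : fderiv ℝ (logLeeForm κ) x u v
      = -2 * (fderiv ℝ (logMetric κ) x u x v + logMetric κ x u v) := by
    have h : HasFDerivAt (logLeeForm κ) _ x :=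
      (hG.hasFDerivAt.clm_apply (hasFDerivAt_id x)).const_smul (-2 : ℝ)
    rw [h.fderiv]
    simp
    ring
  -- By symmetry Γ becomes the first argument of G, so its defining relation applies with w = x and
  -- no inverse matrix is needed.
  have hη' : logLeeForm κ x (christoffel (logMetric κ) x u v)
      = -2 * logMetric κ x (christoffel (logMetric κ) x u v) x := by
    rw [logMetric, radialBilin_comm]; rfl
  have hd := fderiv_radialBilin hG (hasDerivAt_inv hs.ne') (hasDerivAt_logMetric_coeff hκ hs)
  rw [hη, hη', logMetric_christoffel hx hpos]
  change ∀ w u v, fderiv ℝ (logMetric κ) x w u v = _ at hd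
  simp only [hd, logMetric_apply, imProd_self, imProd_swap u x, imProd_swap v x, imProd_swap u v,
    reProd_comm u x, reProd_comm v x, reProd_comm u v]
  field_simp
  ring

end RadialForms

/-! ### Charts of the Hopf surface -/

noncomputable section HopfCharts

variable (α β : ℂ) [hα : Fact (1 < ‖α‖)] [hβ : Fact (1 < ‖β‖)]

/-- Charts are local inverses of the projection followed by the inclusion into ℂ², so all inverse
charts agree with the projection; this makes coordinate expressions independent of the chart. -/
theorem hopfSurface_chart_symm {e : OpenPartialHomeomorph (HopfSurface α β) CTwo}
    (he : e ∈ atlas CTwo (HopfSurface α β)) {x : CTwo} (hx : x ∈ e.target) :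
    ∃ h : x ∈ (puncturedCTwo : Set CTwo), e.symm x = hopfProj α β ⟨x, h⟩ := by
  obtain ⟨z, rfl⟩ := mem_atlas_hopfSurface α β he
  rw [OpenPartialHomeomorph.trans_target] at hx
  have hxp : x ∈ (puncturedCTwo : Set CTwo) := by
    rw [← chartAt_puncturedCTwo_target z]; exact hx.1
  refine ⟨hxp, ?_⟩
  have : (chartAt CTwo z).symm x = ⟨x, hxp⟩ :=
    Subtype.ext (chartAt_puncturedCTwo_symm_apply z hxp)
  rw [OpenPartialHomeomorph.coe_trans_symm, Function.comp_apply, this,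
    (isLocalHomeomorph_hopfProj α β).localInverseAt_symm]

theorem ne_zero_of_mem_chart_target {e : OpenPartialHomeomorph (HopfSurface α β) CTwo}
    (he : e ∈ atlas CTwo (HopfSurface α β)) {x : CTwo} (hx : x ∈ e.target) : x ≠ 0 :=
  (hopfSurface_chart_symm α β he hx).1

theorem hopfSurface_chart_comp_symm {e e' : OpenPartialHomeomorph (HopfSurface α β) CTwo}
    (he : e ∈ atlas CTwo (HopfSurface α β)) (he' : e' ∈ atlas CTwo (HopfSurface α β))
    {x : CTwo} (hx : x ∈ e.target) (hx' : e.symm x ∈ e'.source) :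
    ∃ n : ℤ, (fun y ↦ e' (e.symm y)) =ᶠ[𝓝 x] diagCLM (α ^ n) (β ^ n) :=
  hopfSurface_transition α β he he' (by
    rw [OpenPartialHomeomorph.trans_source]; exact ⟨hx, hx'⟩)

/-- The tangent space at p is identified with ℂ² through the preferred chart at p, so this
derivative is that of a transition map. Transitions are locally linear, so one power n serves for
both the point and the derivative. -/
theorem mfderiv_hopfSurface_chart_symm {e : OpenPartialHomeomorph (HopfSurface α β) CTwo}
    (he : e ∈ atlas CTwo (HopfSurface α β)) {x : CTwo} (hx : x ∈ e.target) :
    ∃ n : ℤ, chartAt CTwo (e.symm x) (e.symm x) = diagCLM (α ^ n) (β ^ n) x ∧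
      mfderiv 𝓘(ℝ, CTwo) 𝓘(ℝ, CTwo) e.symm x = diagCLM (α ^ n) (β ^ n) := by
  obtain ⟨n, hn⟩ := hopfSurface_chart_comp_symm α β he (chart_mem_atlas CTwo (e.symm x)) hx
    (mem_chart_source CTwo _)
  refine ⟨n, hn.eq_of_nhds, ?_⟩
  have hd : MDifferentiableAt 𝓘(ℝ, CTwo) 𝓘(ℝ, CTwo) e.symm x :=
    mdifferentiableAt_atlas_symm he hx
  refine hd.mfderiv.trans ?_
  simp only [mfld_simps, fderivWithin_univ]
  refine (Filter.EventuallyEq.fderiv_eq (f₁ := fun y ↦ chartAt CTwo (e.symm x) (e.symm y))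
    hn).trans ?_
  exact (diagCLM (α ^ n) (β ^ n)).fderiv

theorem hopfProj_eq_of_diagCLM {z w : puncturedCTwo} (n : ℤ)
    (h : w.1 = diagCLM (α ^ n) (β ^ n) z.1) : hopfProj α β w = hopfProj α β z := by
  refine Quotient.sound ⟨⟨hopfPerm α β ^ n, Subgroup.zpow_mem_zpowers _ n⟩, Subtype.ext ?_⟩
  rw [h]
  exact hopfPerm_zpow α β n z

theorem exists_diagCLM_of_hopfProj_eq {z w : puncturedCTwo}
    (h : hopfProj α β w = hopfProj α β z) : ∃ n : ℤ, w.1 = diagCLM (α ^ n) (β ^ n) z.1 := by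
  obtain ⟨γ, hγ⟩ : w ∈ MulAction.orbit (HopfGroup α β) z := Quotient.exact h
  obtain ⟨n, -, hn⟩ := hopfGroup_smul α β γ
  refine ⟨n, ?_⟩
  rw [← hγ]
  exact hn z

theorem mfderiv_hopfProj (z : puncturedCTwo) :
    ∃ n : ℤ, chartAt CTwo (hopfProj α β z) (hopfProj α β z) = diagCLM (α ^ n) (β ^ n) z.1 ∧
      mfderiv 𝓘(ℝ, CTwo) 𝓘(ℝ, CTwo) (hopfProj α β) z = diagCLM (α ^ n) (β ^ n) := by
  set e := chartAt CTwo (hopfProj α β z) with he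
  have hea : e ∈ atlas CTwo (HopfSurface α β) := chart_mem_atlas CTwo _
  have hsrc : hopfProj α β z ∈ e.source := mem_chart_source CTwo _
  have htgt := e.map_source hsrc
  obtain ⟨hp, hpe⟩ := hopfSurface_chart_symm α β hea htgt
  rw [e.left_inv hsrc] at hpe
  obtain ⟨n, hn⟩ := exists_diagCLM_of_hopfProj_eq α β hpe.symm
  change e (hopfProj α β z) = _ at hn
  refine ⟨n, hn, ?_⟩
  set A := diagCLM (α ^ n) (β ^ n) with hA
  have hnear : ∀ᶠ y in 𝓝 z.1, A y ∈ e.target :=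
    A.continuous.continuousAt.eventually_mem (e.open_target.mem_nhds (by rw [← hn]; exact htgt))
  have hproj : ∀ w : puncturedCTwo, A w.1 ∈ e.target → hopfProj α β w = e.symm (A w.1) := by
    intro w hw
    obtain ⟨h, h'⟩ := hopfSurface_chart_symm α β hea hw
    rw [h']
    exact (hopfProj_eq_of_diagCLM α β n rfl).symm
  have hev : hopfProj α β =ᶠ[𝓝 z] fun w ↦ e.symm (A w.1) := by
    filter_upwards [continuous_subtype_val.continuousAt.eventually hnear] with w hw
    exact hproj w hw
  have hd : MDifferentiableAt 𝓘(ℝ, CTwo) 𝓘(ℝ, CTwo) (hopfProj α β) z := by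
    refine MDifferentiableAt.congr_of_eventuallyEq ?_ hev
    have h1 : MDifferentiableAt 𝓘(ℝ, CTwo) 𝓘(ℝ, CTwo) e.symm (A z.1) :=
      mdifferentiableAt_atlas_symm hea (by rw [← hn]; exact htgt)
    have h2 : MDifferentiableAt 𝓘(ℝ, CTwo) 𝓘(ℝ, CTwo) (Subtype.val : puncturedCTwo → CTwo) z :=
      (contMDiff_subtype_val (n := 1)).mdifferentiableAt (by simp)
    have h3 : MDifferentiableAt 𝓘(ℝ, CTwo) 𝓘(ℝ, CTwo) A z.1 :=
      A.differentiableAt.mdifferentiableAt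
    exact h1.comp z (h3.comp z h2)
  refine hd.mfderiv.trans ?_
  simp only [mfld_simps, fderivWithin_univ]
  have hfin : (fun y ↦ e (hopfProj α β ((chartAt CTwo z).symm y))) =ᶠ[𝓝 z.1] A := by
    filter_upwards [hnear, puncturedCTwo.isOpen.mem_nhds z.2] with y hy hyp
    have : (chartAt CTwo z).symm y = ⟨y, hyp⟩ :=
      Subtype.ext (chartAt_puncturedCTwo_symm_apply z hyp)
    rw [this, hproj ⟨y, hyp⟩ hy, e.right_inv hy]
  exact hfin.fderiv_eq.trans A.fderiv

theorem hopfProj_surjective : Function.Surjective (hopfProj α β) := Quotient.mk_surjective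

theorem mfderiv_hopfProj_surjective (z : puncturedCTwo) :
    Function.Surjective (mfderiv 𝓘(ℝ, CTwo) 𝓘(ℝ, CTwo) (hopfProj α β) z) := by
  obtain ⟨n, -, hn⟩ := mfderiv_hopfProj α β z
  rw [hn]
  exact diagCLM_surjective (zpow_ne_zero n (ne_zero_of_one_lt_norm α))
    (zpow_ne_zero n (ne_zero_of_one_lt_norm β))

theorem mfderiv_hopfProj_I_smul (z : puncturedCTwo) (u : CTwo) :
    mfderiv 𝓘(ℝ, CTwo) 𝓘(ℝ, CTwo) (hopfProj α β) z (Complex.I • u : CTwo) =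
      complexStructure (hopfProj α β z)
        (mfderiv 𝓘(ℝ, CTwo) 𝓘(ℝ, CTwo) (hopfProj α β) z u) := by
  obtain ⟨n, -, hn⟩ := mfderiv_hopfProj α β z
  rw [hn]
  exact diagCLM_I_smul _ _ u

/-! ### Descent of the metric to the Hopf surface -/

/-- The field of bilinear forms on `H_{α,β}` induced by `logMetric κ`. -/
def hopfInner (κ : ℝ → ℝ) (p : HopfSurface α β) :
    TangentSpace 𝓘(ℝ, CTwo) p →L[ℝ] TangentSpace 𝓘(ℝ, CTwo) p →L[ℝ] ℝ :=
  show CTwo →L[ℝ] CTwo →L[ℝ] ℝ from logMetric κ (chartAt CTwo p p)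

variable {α β} {κ : ℝ → ℝ}

theorem logMetric_diagCLM_zpow {α β : ℂ} [Fact (1 < ‖α‖)] (hαβ : ‖α‖ = ‖β‖)
    (hper : Function.Periodic κ (2 * Real.log ‖α‖)) (n : ℤ) {x : CTwo} (hx : x ≠ 0) (u v : CTwo) :
    logMetric κ (diagCLM (α ^ n) (β ^ n) x) (diagCLM (α ^ n) (β ^ n) u)
      (diagCLM (α ^ n) (β ^ n) v) = logMetric κ x u v := by
  refine logMetric_diagCLM (by simp [hαβ]) (zpow_ne_zero n (ne_zero_of_one_lt_norm α)) hx
    (fun t ↦ ?_) u v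
  rw [norm_zpow, Real.log_zpow, ← hper.int_mul n t]
  congr 1
  ring

theorem hopfInner_mfderiv_hopfProj (hαβ : ‖α‖ = ‖β‖)
    (hper : Function.Periodic κ (2 * Real.log ‖α‖)) (z : puncturedCTwo) (u v : CTwo) :
    hopfInner α β κ (hopfProj α β z) (mfderiv 𝓘(ℝ, CTwo) 𝓘(ℝ, CTwo) (hopfProj α β) z u)
      (mfderiv 𝓘(ℝ, CTwo) 𝓘(ℝ, CTwo) (hopfProj α β) z v) = logMetric κ z.1 u v := by
  obtain ⟨n, hn, hn'⟩ := mfderiv_hopfProj α β z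
  rw [hn', hopfInner, hn]
  exact logMetric_diagCLM_zpow hαβ hper n z.2 u v

theorem chartBilin_hopfInner (hαβ : ‖α‖ = ‖β‖) (hper : Function.Periodic κ (2 * Real.log ‖α‖))
    {e : OpenPartialHomeomorph (HopfSurface α β) CTwo} (he : e ∈ atlas CTwo (HopfSurface α β))
    {x : CTwo} (hx : x ∈ e.target) : chartBilin (hopfInner α β κ) e x = logMetric κ x := by
  obtain ⟨n, hn, hn'⟩ := mfderiv_hopfSurface_chart_symm α β he hx
  ext u v
  rw [chartBilin, hn', hopfInner, hn]
  exact logMetric_diagCLM_zpow hαβ hper n (ne_zero_of_mem_chart_target α β he hx) u v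

theorem contMDiff_hopfInner (hαβ : ‖α‖ = ‖β‖) (hper : Function.Periodic κ (2 * Real.log ‖α‖))
    (hκ : ContDiff ℝ ∞ κ) :
    ContMDiff 𝓘(ℝ, CTwo) (𝓘(ℝ, CTwo).prod 𝓘(ℝ, CTwo →L[ℝ] CTwo →L[ℝ] ℝ)) ∞
      (fun p : HopfSurface α β ↦ Bundle.TotalSpace.mk' (CTwo →L[ℝ] CTwo →L[ℝ] ℝ)
        (E := fun p ↦ TangentSpace 𝓘(ℝ, CTwo) p →L[ℝ] TangentSpace 𝓘(ℝ, CTwo) p →L[ℝ] ℝ)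
        p (hopfInner α β κ p)) := by
  intro p
  rw [contMDiffAt_hom_bundle]
  refine ⟨contMDiffAt_id, ?_⟩
  have hea : chartAt CTwo p ∈ atlas CTwo (HopfSurface α β) := chart_mem_atlas CTwo p
  have h0 : chartAt CTwo p p ≠ 0 := ne_zero_of_mem_chart_target α β hea (mem_chart_target CTwo p)
  have h1 : ContMDiffAt 𝓘(ℝ, CTwo) 𝓘(ℝ, CTwo →L[ℝ] CTwo →L[ℝ] ℝ) ∞
      (fun q : HopfSurface α β ↦ logMetric κ (chartAt CTwo p q)) p :=
    ContMDiffAt.comp (g := logMetric κ) (f := chartAt CTwo p) p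
      (((contDiffOn_logMetric hκ).contDiffAt (isOpen_compl_singleton.mem_nhds h0)).contMDiffAt)
      (contMDiffAt_of_mem_maximalAtlas (IsManifold.chart_mem_maximalAtlas p)
        (mem_chart_source CTwo p))
  refine h1.congr_of_eventuallyEq ?_
  filter_upwards [(chartAt CTwo p).open_source.mem_nhds (mem_chart_source CTwo p)] with q hq
  obtain ⟨x, hx, rfl⟩ : ∃ x ∈ (chartAt CTwo p).target, (chartAt CTwo p).symm x = q :=
    ⟨_, (chartAt CTwo p).map_source hq, (chartAt CTwo p).left_inv hq⟩
  ext u v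
  have h2 : (chartAt CTwo p).symm x ∈
      (trivializationAt CTwo (TangentSpace 𝓘(ℝ, CTwo)) p).baseSet := by
    simpa using hq
  -- The trivialization at p reads nearby fibres through the derivative of the inverse chart, so the
  -- local expression is `chartBilin`, that is, G.
  rw [inCoordinates_apply_eq₂ h2 h2 (by simp), 
    ← Bundle.Trivialization.symmL_apply (R := ℝ) _ h2,
    ← Bundle.Trivialization.symmL_apply (R := ℝ) _ h2,
    TangentBundle.symmL_trivializationAt hq]
  have h3 := chartBilin_hopfInner hαβ hper hea hx
  rw [(chartAt CTwo p).right_inv hx, ← h3]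
  simp [mfderivWithin_univ]
  -- The target space of `mfderiv` depends on the base point; regarding the derivatives as
  -- endomorphisms of ℂ² lets the base point be replaced.
  have h4 : ∀ y, y = x → (mfderiv 𝓘(ℝ, CTwo) 𝓘(ℝ, CTwo) (chartAt CTwo p).symm y : CTwo →L[ℝ] CTwo)
      = mfderiv 𝓘(ℝ, CTwo) 𝓘(ℝ, CTwo) (chartAt CTwo p).symm x := by
    rintro _ rfl; rfl
  have h5 := h4 _ ((chartAt CTwo p).right_inv hx)
  exact congrArg₂ (fun a b : CTwo ↦ (show ℝ from hopfInner α β κ ((chartAt CTwo p).symm x) a b))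
    (DFunLike.congr_fun h5 u) (DFunLike.congr_fun h5 v)

end HopfCharts

noncomputable section HopfMetrics

/-! ### The metric on the Hopf surface and its matrix -/

variable {α β : ℂ} [hα : Fact (1 < ‖α‖)] [hβ : Fact (1 < ‖β‖)] {κ : ℝ → ℝ}

variable (α β) in
/-- The metric on `H_{α,β}` induced by `logMetric κ`. -/
def hopfMetric (hαβ : ‖α‖ = ‖β‖) (hper : Function.Periodic κ (2 * Real.log ‖α‖))
    (hκ : ContDiff ℝ ∞ κ) (hpos : ∀ t, 0 < κ t) : SmoothMetric CTwo (HopfSurface α β) where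
  inner := hopfInner α β κ
  symm _ _ _ := radialBilin_comm _ _ _ _ _
  pos p _ hv := logMetric_self_pos (ne_zero_of_mem_chart_target α β (chart_mem_atlas CTwo p)
    (mem_chart_target CTwo p)) (hpos _) hv
  isVonNBounded p := isVonNBounded_logMetric (ne_zero_of_mem_chart_target α β
    (chart_mem_atlas CTwo p) (mem_chart_target CTwo p)) (hpos _)
  contMDiff := contMDiff_hopfInner hαβ hper hκ

theorem hopfF_zero_left_linear (α β : ℂ) (θ : ℝ) (x w : CTwo) :
    fderiv ℝ (hopfF α β) (θ, x) (0, w) = hopfF α β (θ, w) := by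
  have hd : DifferentiableAt ℝ (hopfF α β) (θ, x) := by
    unfold hopfF
    rw [differentiableAt_piLp]
    have h (j : Fin 2) : Differentiable ℝ fun q : ℝ × CTwo ↦ q.2 j := by fun_prop
    intro i
    fin_cases i
    · have := h 0
      simp only [Fin.zero_eta, Matrix.cons_val_zero]; fun_prop
    · have := h 1
      simp only [Fin.mk_one, Matrix.cons_val_one, Matrix.cons_val_fin_one]; fun_prop
  have h1 : HasDerivAt (fun t : ℝ ↦ ((θ, x) : ℝ × CTwo) + t • (0, w)) (0, w) 0 := by
    simpa using ((hasDerivAt_id (0 : ℝ)).smul_const ((0, w) : ℝ × CTwo)).const_add (θ, x)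
  have h2 : HasFDerivAt (hopfF α β) (fderiv ℝ (hopfF α β) (θ, x))
    (((θ, x) : ℝ × CTwo) + (0 : ℝ) • (0, w)) := by simpa using hd.hasFDerivAt
  have h3 := HasFDerivAt.comp_hasDerivAt (l := hopfF α β)
    (f := fun t : ℝ ↦ ((θ, x) : ℝ × CTwo) + t • (0, w)) 0 h2 h1
  have h4 : HasDerivAt (fun t : ℝ ↦ hopfF α β (θ, x) + t • hopfF α β (θ, w))
      (hopfF α β (θ, w)) 0 := by
    simpa using ((hasDerivAt_id (0 : ℝ)).smul_const (hopfF α β (θ, w))).const_add (hopfF α β (θ, x))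
  refine h3.unique (h4.congr_of_eventuallyEq (Filter.Eventually.of_forall fun t ↦ ?_))
  ext i
  fin_cases i <;> simp [hopfF] <;> ring

/-- The point `F_{α,β}(θ, ξ)` of `ℂ² ∖ 0`. -/
def hopfPoint (α β : ℂ) (θ : ℝ) (ξ : SThree) : puncturedCTwo :=
  ⟨hopfF α β (θ, ξ), hopfF_ne_zero α β θ ξ⟩

/-- The vectors of `ℂ²` representing the frame `(e₂, e₃)` at `F_{α,β}(θ, ξ)`. -/
def liftedFrame (α β : ℂ) (θ : ℝ) (ξ : SThree) : Fin 2 → CTwo :=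
  ![Complex.I • (hopfPoint α β θ ξ).1,
    Complex.exp (θ * (α.arg + β.arg) / (2 * Real.pi) * Complex.I) • quatJ (hopfPoint α β θ ξ).1]

theorem normSq_frame_phase (α β : ℂ) (θ : ℝ) :
    Complex.normSq (Complex.exp (θ * (α.arg + β.arg) / (2 * Real.pi) * Complex.I)) = 1 := by
  have h : (θ * (α.arg + β.arg) / (2 * Real.pi) : ℂ)
      = ((θ * (α.arg + β.arg) / (2 * Real.pi) : ℝ) : ℂ) := by push_cast; rfl
  rw [h, Complex.normSq_eq_norm_sq, Complex.norm_exp_ofReal_mul_I, one_pow]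

/-- Since ‖a‖ = ‖b‖, log a and the conjugate of log b have the same real part and differ by i(arg a
+ arg b). The phase is symmetric in a and b, so a single factor relates diag(a, b) ∘ j to j ∘
diag(a, b) in both coordinates. -/
theorem exp_log_eq_phase_mul_conj {a b : ℂ} (hab : ‖a‖ = ‖b‖) (θ : ℝ) :
    Complex.exp (θ * Complex.log a / (2 * Real.pi)) =
      Complex.exp (θ * (a.arg + b.arg) / (2 * Real.pi) * Complex.I) *
        (starRingEnd ℂ) (Complex.exp (θ * Complex.log b / (2 * Real.pi))) := by
  rw [← Complex.exp_conj, ← Complex.exp_add]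
  congr 1
  simp only [Complex.log, hab, map_div₀, map_mul, map_add, Complex.conj_ofReal, Complex.conj_I,
    map_ofNat]
  ring

theorem hopfFrame_eq (hαβ : ‖α‖ = ‖β‖) (θ : ℝ) (ξ : SThree) (i : Fin 2) : hopfFrame α β θ ξ i =
    mfderiv 𝓘(ℝ, CTwo) 𝓘(ℝ, CTwo) (hopfProj α β) (hopfPoint α β θ ξ) (liftedFrame α β θ ξ i) := by
  have h2 : hopfF α β (θ, (frameTwo ξ).2) = Complex.I • hopfF α β (θ, ξ) := by
    ext i
    fin_cases i <;> simp [hopfF, frameTwo] <;> ring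
  have h3 : hopfF α β (θ, (frameThree ξ).2) =
      Complex.exp (θ * (α.arg + β.arg) / (2 * Real.pi) * Complex.I) •
        quatJ (hopfF α β (θ, ξ)) := by
    have e1 := exp_log_eq_phase_mul_conj hαβ θ
    have e2 := exp_log_eq_phase_mul_conj hαβ.symm θ
    rw [add_comm (β.arg : ℂ)] at e2
    ext i
    fin_cases i
    · simp only [hopfF, frameThree, quatJ]
      simp
      rw [e1]; ring
    · simp only [hopfF, frameThree, quatJ]
      simp
      rw [e2]; ring
  fin_cases i
  · refine congrArg (mfderiv 𝓘(ℝ, CTwo) 𝓘(ℝ, CTwo) (hopfProj α β) (hopfPoint α β θ ξ)) ?_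
    exact (hopfF_zero_left_linear α β θ ξ (frameTwo ξ).2).trans h2
  · refine congrArg (mfderiv 𝓘(ℝ, CTwo) 𝓘(ℝ, CTwo) (hopfProj α β) (hopfPoint α β θ ξ)) ?_
    exact (hopfF_zero_left_linear α β θ ξ (frameThree ξ).2).trans h3

theorem norm_exp_mul_log_div (a : ℂ) (θ : ℝ) :
    ‖Complex.exp (θ * Complex.log a / (2 * Real.pi))‖
      = Real.exp (θ * Real.log ‖a‖ / (2 * Real.pi)) := by
  have h : (θ * Complex.log a / (2 * Real.pi) : ℂ)
      = ((θ / (2 * Real.pi) : ℝ) : ℂ) * Complex.log a := by push_cast; ring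
  rw [Complex.norm_exp, h, Complex.re_ofReal_mul, Complex.log_re]
  ring_nf

theorem reProd_hopfF {α β : ℂ} (hαβ : ‖α‖ = ‖β‖) (θ : ℝ) (x : CTwo) :
    reProd (hopfF α β (θ, x)) (hopfF α β (θ, x))
      = Real.exp (θ * Real.log ‖α‖ / Real.pi) * reProd x x := by
  refine (reProd_diagCLM (a := Complex.exp (θ * Complex.log α / (2 * Real.pi)))
    (b := Complex.exp (θ * Complex.log β / (2 * Real.pi))) ?_ x x).trans ?_
  · rw [norm_exp_mul_log_div, norm_exp_mul_log_div, hαβ]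
  · rw [norm_exp_mul_log_div, ← Real.exp_nat_mul]
    congr 2
    push_cast
    field_simp

theorem log_reProd_hopfPoint {α β : ℂ} (hαβ : ‖α‖ = ‖β‖) (θ : ℝ) (ξ : SThree) :
    Real.log (reProd (hopfPoint α β θ ξ).1 (hopfPoint α β θ ξ).1)
      = θ * Real.log ‖α‖ / Real.pi := by
  have h : reProd ξ.1 ξ.1 = 1 := by
    rw [reProd_self, norm_eq_of_mem_sphere ξ, one_pow]
  change Real.log (reProd (hopfF α β (θ, ξ)) (hopfF α β (θ, ξ))) = _
  rw [reProd_hopfF hαβ, h, mul_one, Real.log_exp]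

theorem exists_hopfParam_eq (hαβ : ‖α‖ = ‖β‖) (p : HopfSurface α β) :
    ∃ (θ : ℝ) (ξ : SThree), hopfParam α β θ ξ = p := by
  obtain ⟨z, rfl⟩ := hopfProj_surjective α β p
  have hL : 0 < Real.log ‖α‖ := Real.log_pos hα.out
  have hs := reProd_self_pos z.2
  -- This θ solves log‖z‖² = θ log‖α‖ / π, so F(-θ, z) lies on the unit sphere.
  set θ : ℝ := Real.pi * Real.log (reProd z.1 z.1) / Real.log ‖α‖ with hθ
  have hinv : hopfF α β (θ, hopfF α β (-θ, z.1)) = z.1 := by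
    ext i
    fin_cases i <;> simp [hopfF, ← mul_assoc, ← Complex.exp_add, neg_div]
  have hnorm : hopfF α β (-θ, z.1) ∈ SThree := by
    have h := reProd_hopfF hαβ (-θ) z.1
    have h1 : -θ * Real.log ‖α‖ / Real.pi = -Real.log (reProd z.1 z.1) := by
      rw [hθ]; field_simp
    rw [h1, Real.exp_neg, Real.exp_log hs, inv_mul_cancel₀ hs.ne', reProd_self] at h
    rw [mem_sphere_zero_iff_norm]
    exact (pow_eq_one_iff_of_nonneg (norm_nonneg _) two_ne_zero).mp h
  refine ⟨θ, ⟨_, hnorm⟩, ?_⟩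
  rw [hopfParam]
  congr 1
  exact Subtype.ext hinv

theorem hermitianForm_mfderiv (g : SmoothMetric CTwo (HopfSurface α β)) (z : puncturedCTwo)
    (u v : CTwo) :
    hermitianForm g (hopfProj α β z) (mfderiv 𝓘(ℝ, CTwo) 𝓘(ℝ, CTwo) (hopfProj α β) z u)
      (mfderiv 𝓘(ℝ, CTwo) 𝓘(ℝ, CTwo) (hopfProj α β) z v) =
    (g.inner (hopfProj α β z) (mfderiv 𝓘(ℝ, CTwo) 𝓘(ℝ, CTwo) (hopfProj α β) z u)
      (mfderiv 𝓘(ℝ, CTwo) 𝓘(ℝ, CTwo) (hopfProj α β) z v) : ℂ)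
    - Complex.I * (g.inner (hopfProj α β z)
      (mfderiv 𝓘(ℝ, CTwo) 𝓘(ℝ, CTwo) (hopfProj α β) z (Complex.I • u : CTwo))
      (mfderiv 𝓘(ℝ, CTwo) 𝓘(ℝ, CTwo) (hopfProj α β) z v) : ℂ) := by
  rw [hermitianForm, mfderiv_hopfProj_I_smul]
  rfl

theorem isHermitianMetric_hopfMetric (hαβ : ‖α‖ = ‖β‖)
    (hper : Function.Periodic κ (2 * Real.log ‖α‖)) (hκ : ContDiff ℝ ∞ κ) (hpos : ∀ t, 0 < κ t) :
    IsHermitianMetric (hopfMetric α β hαβ hper hκ hpos) :=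
  fun p X Y ↦ radialBilin_I_smul_I_smul _ _ (chartAt CTwo p p) (show CTwo from X) (show CTwo from Y)

theorem reProd_smul_smul (c : ℂ) (u v : CTwo) :
    reProd (c • u) (c • v) = Complex.normSq c * reProd u v := by
  simp [reProd_apply, Complex.normSq_apply]; ring

theorem reProd_smul_right (c : ℂ) (u v : CTwo) :
    reProd u (c • v) = c.re * reProd u v - c.im * imProd u v := by
  simp [reProd_apply, imProd_apply]; ring

theorem imProd_smul_right (c : ℂ) (u v : CTwo) :
    imProd u (c • v) = c.re * imProd u v + c.im * reProd u v := by
  simp [reProd_apply, imProd_apply]; ring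

theorem logMetric_frame {x : CTwo} (hx : x ≠ 0) {c : ℂ} (hc : Complex.normSq c = 1) (i j : Fin 2) :
    ((logMetric κ x ((![Complex.I • x, c • quatJ x] : Fin 2 → CTwo) i)
        ((![Complex.I • x, c • quatJ x] : Fin 2 → CTwo) j) : ℝ) : ℂ)
      - Complex.I * (logMetric κ x (Complex.I • (![Complex.I • x, c • quatJ x] : Fin 2 → CTwo) i)
        ((![Complex.I • x, c • quatJ x] : Fin 2 → CTwo) j) : ℝ)
      = (!![(κ (Real.log (reProd x x)) : ℂ), 0; 0, 1] : Matrix (Fin 2) (Fin 2) ℂ) i j := by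
  have hs := (reProd_self_pos hx).ne'
  have h1 : reProd x (c • quatJ x) = 0 := by
    rw [reProd_smul_right, reProd_quatJ, imProd_quatJ]; ring
  have h2 : imProd x (c • quatJ x) = 0 := by
    rw [imProd_smul_right, reProd_quatJ, imProd_quatJ]; ring
  have h3 : reProd (c • quatJ x) x = 0 := by rw [reProd_comm, h1]
  have h4 : imProd (c • quatJ x) x = 0 := by rw [imProd_swap, h2, neg_zero]
  have h5 : reProd (c • quatJ x) (c • quatJ x) = reProd x x := by
    rw [reProd_smul_smul, hc, reProd_quatJ_self, one_mul]
  fin_cases i <;> fin_cases j <;>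
    simp [-inv_mul_cancel₀, -Complex.ofReal_add, -Complex.ofReal_mul, logMetric_apply,
      reProd_I_smul, reProd_I_smul_right, imProd_I_smul, imProd_I_smul_right, imProd_self,
      h1, h2, h3, h4, h5, hs]
  field_simp
  ring

theorem hasMatrixDiag_hopfMetric {k : ℝ → ℝ} (hαβ : ‖α‖ = ‖β‖)
    (hper : Function.Periodic κ (2 * Real.log ‖α‖)) (hκ : ContDiff ℝ ∞ κ) (hpos : ∀ t, 0 < κ t)
    (hk : ∀ θ, κ (θ * Real.log ‖α‖ / Real.pi) = k θ) :
    HasMatrixDiag α β k (hopfMetric α β hαβ hper hκ hpos) := by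
  refine ⟨isHermitianMetric_hopfMetric hαβ hper hκ hpos, fun θ ξ ↦ ?_⟩
  ext i j
  have h := hermitianForm_mfderiv (hopfMetric α β hαβ hper hκ hpos) (hopfPoint α β θ ξ)
    (liftedFrame α β θ ξ i) (liftedFrame α β θ ξ j)
  have h1 := fun u v ↦ hopfInner_mfderiv_hopfProj (κ := κ) hαβ hper (hopfPoint α β θ ξ) u v
  change ∀ u v, (hopfMetric α β hαβ hper hκ hpos).inner _ _ _ = _ at h1
  rw [h1, h1] at h
  rw [Matrix.of_apply, hopfFrame_eq hαβ, hopfFrame_eq hαβ]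
  refine h.trans ?_
  have h2 := logMetric_frame (κ := κ) (hopfPoint α β θ ξ).2
    (c := Complex.exp (θ * (α.arg + β.arg) / (2 * Real.pi) * Complex.I)) 
    (normSq_frame_phase α β θ) i j
  rw [log_reProd_hopfPoint hαβ, hk] at h2
  exact h2

/-! ### Uniqueness -/

/-- By J-invariance, B(b, ic) = -B(ib, c). The values on (b, c) and (ib, c) for frame vectors, which
are the two real components of the Hermitian matrix, therefore determine B. -/
theorem eq_of_eq_on_frame {B B' : CTwo →L[ℝ] CTwo →L[ℝ] ℝ}
    (hB : ∀ u v, B (Complex.I • u) (Complex.I • v) = B u v)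
    (hB' : ∀ u v, B' (Complex.I • u) (Complex.I • v) = B' u v) {b : Fin 2 → CTwo}
    (hspan : ∀ u : CTwo, ∃ c : Fin 2 → ℂ, u = c 0 • b 0 + c 1 • b 1)
    (h : ∀ i j, B (b i) (b j) = B' (b i) (b j))
    (h' : ∀ i j, B (Complex.I • b i) (b j) = B' (Complex.I • b i) (b j)) : B = B' := by
  have h'' : ∀ i j, B (b i) (Complex.I • b j) = B' (b i) (Complex.I • b j) := by
    intro i j
    rw [← hB, ← hB', smul_smul, Complex.I_mul_I, neg_one_smul, map_neg, map_neg, h']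
  have hsm : ∀ (c : ℂ) (u : CTwo), c • u = c.re • u + c.im • (Complex.I • u) := by
    intro c u
    ext i
    apply Complex.ext
    all_goals simp
    all_goals ring
  ext u v
  obtain ⟨c, rfl⟩ := hspan u
  obtain ⟨d, rfl⟩ := hspan v
  simp only [hsm (c _), hsm (d _), map_add, map_smul, add_apply, smul_apply, h, h', h'', hB, hB']

theorem liftedFrame_span (α β : ℂ) (θ : ℝ) (ξ : SThree) (u : CTwo) : ∃ c : Fin 2 → ℂ,
    u = c 0 • liftedFrame α β θ ξ 0 + c 1 • liftedFrame α β θ ξ 1 := by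
  set x := (hopfPoint α β θ ξ).1 with hx
  set c : ℂ := Complex.exp (θ * (α.arg + β.arg) / (2 * Real.pi) * Complex.I) with hc
  have hc0 : c ≠ 0 := Complex.exp_ne_zero _
  have hs : (reProd x x : ℂ) ≠ 0 :=
    Complex.ofReal_ne_zero.mpr (reProd_self_pos (hopfPoint α β θ ξ).2).ne'
  -- These are the coefficients of u along x and jx, divided by i and by the phase because the frame
  -- is (ix, c jx).
  refine ⟨![(reProd x u + imProd x u * Complex.I) / (reProd x x * Complex.I),
    (reProd (quatJ x) u + imProd (quatJ x) u * Complex.I) / (reProd x x * c)], ?_⟩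
  ext i
  have h := congrArg (fun w : CTwo ↦ w i) (reProd_self_smul_eq x u)
  simp only [PiLp.add_apply, PiLp.smul_apply, smul_eq_mul, Complex.real_smul] at h
  simp only [liftedFrame, ← hx, ← hc, PiLp.add_apply, PiLp.smul_apply, smul_eq_mul,
    Matrix.cons_val_zero, Matrix.cons_val_one, Matrix.cons_val_fin_one]
  field_simp
  linear_combination h

theorem HasMatrixDiag.unique (hαβ : ‖α‖ = ‖β‖) {k : ℝ → ℝ}
    {g g' : SmoothMetric CTwo (HopfSurface α β)}
    (hg : HasMatrixDiag α β k g) (hg' : HasMatrixDiag α β k g') : g' = g := by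
  have key : g'.inner = g.inner := by
    funext p
    obtain ⟨θ, ξ, rfl⟩ := exists_hopfParam_eq hαβ p
    set z := hopfPoint α β θ ξ with hz
    set D : CTwo →L[ℝ] CTwo := mfderiv 𝓘(ℝ, CTwo) 𝓘(ℝ, CTwo) (hopfProj α β) z with hD
    have hDI : ∀ u, D (Complex.I • u) = Complex.I • D u := mfderiv_hopfProj_I_smul α β z
    let P (g : SmoothMetric CTwo (HopfSurface α β)) : CTwo →L[ℝ] CTwo →L[ℝ] ℝ :=
      ContinuousLinearMap.bilinearComp
        (show CTwo →L[ℝ] CTwo →L[ℝ] ℝ from g.inner (hopfParam α β θ ξ)) D D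
    have hP (g : SmoothMetric CTwo (HopfSurface α β)) (hg : HasMatrixDiag α β k g) :
        (∀ u v, P g (Complex.I • u) (Complex.I • v) = P g u v) ∧ ∀ i j,
        (P g (liftedFrame α β θ ξ i) (liftedFrame α β θ ξ j) : ℂ)
          - Complex.I * (P g (Complex.I • liftedFrame α β θ ξ i) (liftedFrame α β θ ξ j) : ℂ)
          = (!![(k θ : ℂ), 0; 0, 1] : Matrix (Fin 2) (Fin 2) ℂ) i j := by
      refine ⟨fun u v ↦ ?_, fun i j ↦ ?_⟩
      · have := hg.1 (hopfParam α β θ ξ) (D u) (D v)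
        change g.inner (hopfParam α β θ ξ) (D (Complex.I • u)) (D (Complex.I • v)) = _
        rw [hDI, hDI]
        exact this
      · rw [← hg.2 θ ξ, Matrix.of_apply, hopfFrame_eq hαβ, hopfFrame_eq hαβ]
        exact (hermitianForm_mfderiv g z _ _).symm
    have hPP : P g' = P g := by
      have hri : ∀ i j, P g' (liftedFrame α β θ ξ i) (liftedFrame α β θ ξ j) =
          P g (liftedFrame α β θ ξ i) (liftedFrame α β θ ξ j) ∧
          P g' (Complex.I • liftedFrame α β θ ξ i) (liftedFrame α β θ ξ j) =
          P g (Complex.I • liftedFrame α β θ ξ i) (liftedFrame α β θ ξ j) := by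
        intro i j
        have h := ((hP g' hg').2 i j).trans ((hP g hg).2 i j).symm
        have h1 := congrArg Complex.re h
        have h2 := congrArg Complex.im h
        simp at h1 h2
        exact ⟨h1, h2⟩
      exact eq_of_eq_on_frame (hP g' hg').1 (hP g hg).1 (liftedFrame_span α β θ ξ)
        (fun i j ↦ (hri i j).1) (fun i j ↦ (hri i j).2)
    have hsurj := mfderiv_hopfProj_surjective α β z
    refine ContinuousLinearMap.ext fun X ↦ ContinuousLinearMap.ext fun Y ↦ ?_
    obtain ⟨u, rfl⟩ := hsurj X
    obtain ⟨v, rfl⟩ := hsurj Y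
    exact DFunLike.congr_fun (DFunLike.congr_fun hPP u) v
  cases g
  cases g'
  simp only at key
  subst key
  rfl

end HopfMetrics

noncomputable section HopfLeeForms

/-! ### Kähler factors and Lee forms -/

variable {α β : ℂ} [hα : Fact (1 < ‖α‖)] [hβ : Fact (1 < ‖β‖)] {κ : ℝ → ℝ}

/-- Applied to the fundamental form and alternated, this gives d(e^{-F}Ω) = e^{-F}(dΩ - dF ∧ Ω). -/
theorem fderiv_exp_neg_smul {F : CTwo → ℝ} {G : CTwo → CTwo →L[ℝ] CTwo →L[ℝ] ℝ} {x : CTwo}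
    {F' : CTwo →L[ℝ] ℝ} (hF : HasFDerivAt F F' x) (hG : DifferentiableAt ℝ G x) (w u v : CTwo) :
    fderiv ℝ (fun y ↦ Real.exp (-F y) • G y) x w u v =
      Real.exp (-F x) * (fderiv ℝ G x w u v - F' w * G x u v) := by
  have hd : DifferentiableAt ℝ (fun y ↦ Real.exp (-F y) • G y) x := by
    have h1 : DifferentiableAt ℝ (fun y ↦ Real.exp (-F y) • ContinuousLinearMap.id ℝ CTwo) x :=
      hF.differentiableAt.neg.exp.smul_const _
    have h2 : (fun y ↦ Real.exp (-F y) • G y)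
        = fun y ↦ (G y).comp (Real.exp (-F y) • ContinuousLinearMap.id ℝ CTwo) := by
      funext y
      ext u v
      simp
    rw [h2]
    exact hG.clm_comp h1
  have h1 : HasDerivAt (fun t : ℝ ↦ x + t • w) w 0 := by
    simpa using ((hasDerivAt_id (0 : ℝ)).smul_const w).const_add x
  have h2 : HasFDerivAt F F' (x + (0 : ℝ) • w) := by simpa using hF
  have h3 : HasFDerivAt G (fderiv ℝ G x) (x + (0 : ℝ) • w) := by simpa using hG.hasFDerivAt
  have h4 : HasDerivAt (fun t : ℝ ↦ F (x + t • w)) (F' w) 0 :=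
    HasFDerivAt.comp_hasDerivAt (l := F) (f := fun t : ℝ ↦ x + t • w) 0 h2 h1
  have h5 : HasDerivAt (fun t : ℝ ↦ G (x + t • w)) (fderiv ℝ G x w) 0 :=
    HasFDerivAt.comp_hasDerivAt (l := G) (f := fun t : ℝ ↦ x + t • w) 0 h3 h1
  have h6 : HasDerivAt (fun t : ℝ ↦ G (x + t • w) u v) (fderiv ℝ G x w u v) 0 := by
    simpa using (h5.clm_apply (hasDerivAt_const (0 : ℝ) u)).clm_apply (hasDerivAt_const (0 : ℝ) v)
  refine fderiv_apply_apply_eq hd ((h4.fun_neg.exp.fun_mul h6).congr_deriv ?_)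
  simp
  ring

/-- Two functions `F₁`, `F₂` with `e^{-F₁} Ω` and `e^{-F₂} Ω` closed at `x`, where `Ω` is the
fundamental form of `logMetric κ`, have the same differential at `x`. -/
theorem eq_of_exp_smul_logMetric_closed (hκ : ContDiff ℝ ∞ κ) {x : CTwo} (hx : x ≠ 0)
    (hpos : 0 < κ (Real.log (reProd x x))) {F₁ F₂ : CTwo → ℝ} {F₁' F₂' : CTwo →L[ℝ] ℝ}
    (hF₁ : HasFDerivAt F₁ F₁' x) (hF₂ : HasFDerivAt F₂ F₂' x)
    (h₁ : ∀ u v w, let Ω := fun y ↦ Real.exp (-F₁ y) • (logMetric κ y).comp mulI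
      fderiv ℝ Ω x u v w - fderiv ℝ Ω x v u w + fderiv ℝ Ω x w u v = 0)
    (h₂ : ∀ u v w, let Ω := fun y ↦ Real.exp (-F₂ y) • (logMetric κ y).comp mulI
      fderiv ℝ Ω x u v w - fderiv ℝ Ω x v u w + fderiv ℝ Ω x w u v = 0) : F₁' = F₂' := by
  have hG : DifferentiableAt ℝ (fun y ↦ (logMetric κ y).comp mulI) x :=
    (differentiableAt_logMetric hκ hx).clm_comp (differentiableAt_const _)
  rw [← sub_eq_zero]
  -- Both closedness conditions express dΩ, as dF₁ ∧ Ω and as dF₂ ∧ Ω, so (dF₁ - dF₂) ∧ Ω = 0.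
  refine eq_zero_of_wedge_logMetric hx hpos _ fun u v w ↦ ?_
  have e₁ := h₁ u v w
  have e₂ := h₂ u v w
  simp only [fderiv_exp_neg_smul hF₁ hG, ← mul_sub, ← mul_add, mul_eq_zero, Real.exp_ne_zero,
    false_or] at e₁
  simp only [fderiv_exp_neg_smul hF₂ hG, ← mul_sub, ← mul_add, mul_eq_zero, Real.exp_ne_zero,
    false_or] at e₂
  simp only [ContinuousLinearMap.comp_apply, mulI_apply] at e₁ e₂
  simp only [sub_apply]
  linear_combination e₂ - e₁

/-- `f` is given in all charts over `U` by functions `Ψ(log ‖x‖²)` with `Ψ' = -κ`. -/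
def IsLogPotentialOn (κ : ℝ → ℝ) (f : HopfSurface α β → ℝ) (U : Set (HopfSurface α β)) : Prop :=
  ∀ e ∈ atlas CTwo (HopfSurface α β), ∀ x ∈ e.target, e.symm x ∈ U →
    ∃ Ψ : ℝ → ℝ, ContDiff ℝ ∞ Ψ ∧ (∀ t, HasDerivAt Ψ (-κ t) t) ∧
      (fun y ↦ f (e.symm y)) =ᶠ[𝓝 x] fun y ↦ Ψ (Real.log (reProd y y))

theorem exists_primitive_neg (hκ : ContDiff ℝ ∞ κ) :
    ∃ Φ : ℝ → ℝ, ContDiff ℝ ∞ Φ ∧ ∀ t, HasDerivAt Φ (-κ t) t := by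
  have h : ∀ t, HasDerivAt (fun t ↦ ∫ s in (0 : ℝ)..t, -κ s) (-κ t) t := fun t ↦
    hκ.continuous.neg.integral_hasStrictDerivAt 0 t |>.hasDerivAt
  refine ⟨_, ?_, h⟩
  rw [contDiff_infty_iff_deriv]
  refine ⟨fun t ↦ (h t).differentiableAt, ?_⟩
  rw [show deriv (fun t ↦ ∫ s in (0 : ℝ)..t, -κ s) = fun t ↦ -κ t from funext fun t ↦ (h t).deriv]
  exact hκ.neg

theorem exists_isLogPotentialOn (hαβ : ‖α‖ = ‖β‖)
    (hper : Function.Periodic κ (2 * Real.log ‖α‖)) (hκ : ContDiff ℝ ∞ κ) (p : HopfSurface α β) :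
    ∃ (f : HopfSurface α β → ℝ), IsLogPotentialOn κ f (chartAt CTwo p).source := by
  obtain ⟨Φ, hΦ, hΦ'⟩ := exists_primitive_neg hκ
  refine ⟨fun q ↦ Φ (Real.log (reProd (chartAt CTwo p q) (chartAt CTwo p q))), ?_⟩
  intro e he x hx hxU
  obtain ⟨n, hn⟩ := hopfSurface_chart_comp_symm α β he (chart_mem_atlas CTwo p) hx hxU
  -- Another chart differs by the n-th power of the generator, which shifts log s by n periods. Φ
  -- need not be periodic, but its derivative -κ is, so the shifted function is again a primitive.
  refine ⟨fun t ↦ Φ (t + n * (2 * Real.log ‖α‖)), hΦ.comp (contDiff_id.add contDiff_const),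
    fun t ↦ ?_, ?_⟩
  · have h := (hΦ' (t + n * (2 * Real.log ‖α‖))).comp_add_const t _
    rwa [hper.int_mul n t] at h
  · filter_upwards [hn, isOpen_compl_singleton.mem_nhds (ne_zero_of_mem_chart_target α β he hx)]
      with y hy hy0
    have ha : 0 < ‖α ^ n‖ := norm_pos_iff.mpr (zpow_ne_zero n (ne_zero_of_one_lt_norm α))
    rw [hy, reProd_diagCLM (by simp [hαβ]), Real.log_mul (pow_pos ha 2).ne'
      (reProd_self_pos hy0).ne',
      Real.log_pow, norm_zpow, Real.log_zpow]
    congr 1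
    push_cast
    ring

/-! ### The Lee form on the Hopf surface -/

/-- The Lee form of `hopfMetric`. -/
def hopfLeeForm (κ : ℝ → ℝ) (p : HopfSurface α β) : TangentSpace 𝓘(ℝ, CTwo) p →L[ℝ] ℝ :=
  show CTwo →L[ℝ] ℝ from logLeeForm κ (chartAt CTwo p p)

theorem chartForm_hopfLeeForm (hαβ : ‖α‖ = ‖β‖) (hper : Function.Periodic κ (2 * Real.log ‖α‖))
    {e : OpenPartialHomeomorph (HopfSurface α β) CTwo} (he : e ∈ atlas CTwo (HopfSurface α β))
    {x : CTwo} (hx : x ∈ e.target) : chartForm (hopfLeeForm κ) e x = logLeeForm κ x := by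
  obtain ⟨n, hn, hn'⟩ := mfderiv_hopfSurface_chart_symm α β he hx
  ext u
  rw [chartForm, hn', hopfLeeForm, hn]
  -- The Euler field is preserved by linear maps, so the invariance of G applies with x itself as
  -- first vector.
  exact congrArg (fun r : ℝ ↦ (-2) * r)
    (logMetric_diagCLM_zpow hαβ hper n (ne_zero_of_mem_chart_target α β he hx) x u)

theorem mvfderiv_eq_of_hasFDerivAt {f : HopfSurface α β → ℝ} {p : HopfSurface α β}
    (hf : MDifferentiableAt 𝓘(ℝ, CTwo) 𝓘(ℝ, ℝ) f p) {F' : CTwo →L[ℝ] ℝ}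
    (hF : HasFDerivAt (fun y ↦ f ((chartAt CTwo p).symm y)) F' (chartAt CTwo p p)) :
    mvfderiv 𝓘(ℝ, CTwo) f p = F' := by
  have h : mfderiv 𝓘(ℝ, CTwo) 𝓘(ℝ, ℝ) f p = F' := by
    refine hf.mfderiv.trans ?_
    simp only [mfld_simps, fderivWithin_univ]
    exact hF.fderiv
  ext v
  exact DFunLike.congr_fun h v

theorem IsLogPotentialOn.contMDiffOn {f : HopfSurface α β → ℝ} {U : Set (HopfSurface α β)}
    (hf : IsLogPotentialOn κ f U) : ContMDiffOn 𝓘(ℝ, CTwo) 𝓘(ℝ, ℝ) ∞ f U := by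
  intro q hq
  refine ContMDiffAt.contMDiffWithinAt ?_
  set e := chartAt CTwo q with he
  have hea : e ∈ atlas CTwo (HopfSurface α β) := chart_mem_atlas CTwo q
  have hsrc : q ∈ e.source := mem_chart_source CTwo q
  obtain ⟨Ψ, hΨ, -, hev⟩ := hf e hea (e q) (e.map_source hsrc) (by rwa [e.left_inv hsrc])
  have hne := ne_zero_of_mem_chart_target α β hea (e.map_source hsrc)
  have h1 : ContDiffAt ℝ ∞ (fun y : CTwo ↦ Ψ (Real.log (reProd y y))) (e q) :=
    hΨ.contDiffAt.comp (e q) (contDiff_reProd_self.contDiffAt.log (reProd_self_pos hne).ne')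
  have h2 : ContMDiffAt 𝓘(ℝ, CTwo) 𝓘(ℝ, CTwo) ∞ e q :=
    contMDiffAt_of_mem_maximalAtlas (IsManifold.chart_mem_maximalAtlas q) hsrc
  have h3 : ContMDiffAt 𝓘(ℝ, CTwo) 𝓘(ℝ, ℝ) ∞ (fun p ↦ Ψ (Real.log (reProd (e p) (e p)))) q :=
    ContMDiffAt.comp (g := fun y : CTwo ↦ Ψ (Real.log (reProd y y))) (f := e) q h1.contMDiffAt h2
  refine h3.congr_of_eventuallyEq ?_
  filter_upwards [h2.continuousAt.eventually hev, e.open_source.mem_nhds hsrc] with p hp hps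
  rw [← hp, e.left_inv hps]

theorem chartBilin_fundamentalForm (hαβ : ‖α‖ = ‖β‖)
    (hper : Function.Periodic κ (2 * Real.log ‖α‖)) (hκ : ContDiff ℝ ∞ κ) (hpos : ∀ t, 0 < κ t)
    (f : HopfSurface α β → ℝ)
    {e : OpenPartialHomeomorph (HopfSurface α β) CTwo} (he : e ∈ atlas CTwo (HopfSurface α β))
    {x : CTwo} (hx : x ∈ e.target) :
    chartBilin (fun p ↦ Real.exp (-f p) • fundamentalForm (hopfMetric α β hαβ hper hκ hpos) p) e x
      = Real.exp (-f (e.symm x)) • (logMetric κ x).comp mulI := by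
  rw [← chartBilin_hopfInner hαβ hper he hx]
  obtain ⟨n, hn, hn'⟩ := mfderiv_hopfSurface_chart_symm α β he hx
  ext u v
  simp only [chartBilin, hn']
  refine congrArg (fun y ↦ Real.exp (-f (e.symm x)) *
    hopfInner α β κ (e.symm x) y (diagCLM (α ^ n) (β ^ n) v)) ?_
  exact (diagCLM_I_smul _ _ u).symm

theorem eventually_chartBilin_fundamentalForm (hαβ : ‖α‖ = ‖β‖)
    (hper : Function.Periodic κ (2 * Real.log ‖α‖)) (hκ : ContDiff ℝ ∞ κ) (hpos : ∀ t, 0 < κ t)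
    (f : HopfSurface α β → ℝ)
    {e : OpenPartialHomeomorph (HopfSurface α β) CTwo} (he : e ∈ atlas CTwo (HopfSurface α β))
    {x : CTwo} (hx : x ∈ e.target) :
    chartBilin (fun p ↦ Real.exp (-f p) • fundamentalForm (hopfMetric α β hαβ hper hκ hpos) p) e
      =ᶠ[𝓝 x] fun y ↦ Real.exp (-f (e.symm y)) • (logMetric κ y).comp mulI := by
  filter_upwards [e.open_target.mem_nhds hx] with y hy
  exact chartBilin_fundamentalForm hαβ hper hκ hpos f he hy

theorem IsLogPotentialOn.isKaehlerFactorOn (hαβ : ‖α‖ = ‖β‖)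
    (hper : Function.Periodic κ (2 * Real.log ‖α‖)) (hκ : ContDiff ℝ ∞ κ) (hpos : ∀ t, 0 < κ t)
    {f : HopfSurface α β → ℝ} {U : Set (HopfSurface α β)} (hU : IsOpen U)
    (hf : IsLogPotentialOn κ f U) : IsKaehlerFactorOn (hopfMetric α β hαβ hper hκ hpos) f U := by
  refine ⟨hU, hf.contMDiffOn, fun e he x hx hxU u v w ↦ ?_⟩
  obtain ⟨Ψ, hΨ, hΨ', hev⟩ := hf e he x hx hxU
  have h : chartBilin (fun p ↦ Real.exp (-f p) •
      fundamentalForm (hopfMetric α β hαβ hper hκ hpos) p) e =ᶠ[𝓝 x]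
      fun y ↦ Real.exp (-Ψ (Real.log (reProd y y))) • (logMetric κ y).comp mulI := by
    filter_upwards [eventually_chartBilin_fundamentalForm hαβ hper hκ hpos f he hx, hev]
      with y hy hy'
    rw [hy, hy']
  rw [h.fderiv_eq]
  exact exp_smul_logMetric_closed hκ hΨ' hΨ (ne_zero_of_mem_chart_target α β he hx) u v w

theorem isLCK_hopfMetric (hαβ : ‖α‖ = ‖β‖)
    (hper : Function.Periodic κ (2 * Real.log ‖α‖)) (hκ : ContDiff ℝ ∞ κ) (hpos : ∀ t, 0 < κ t) :
    IsLCK (hopfMetric α β hαβ hper hκ hpos) := by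
  refine ⟨isHermitianMetric_hopfMetric hαβ hper hκ hpos, fun p ↦ ?_⟩
  obtain ⟨f, hf⟩ := exists_isLogPotentialOn hαβ hper hκ p
  exact ⟨_, f, mem_chart_source CTwo p,
    hf.isKaehlerFactorOn hαβ hper hκ hpos (chartAt CTwo p).open_source⟩

/-- The differential of any Kähler factor is the Lee form. -/
theorem mvfderiv_of_isKaehlerFactorOn (hαβ : ‖α‖ = ‖β‖)
    (hper : Function.Periodic κ (2 * Real.log ‖α‖)) (hκ : ContDiff ℝ ∞ κ) (hpos : ∀ t, 0 < κ t)
    {f : HopfSurface α β → ℝ} {U : Set (HopfSurface α β)}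
    (hf : IsKaehlerFactorOn (hopfMetric α β hαβ hper hκ hpos) f U) {q : HopfSurface α β}
    (hq : q ∈ U) : mvfderiv 𝓘(ℝ, CTwo) f q = hopfLeeForm κ q := by
  obtain ⟨hU, hsm, hcl⟩ := hf
  set e := chartAt CTwo q with he
  have hea : e ∈ atlas CTwo (HopfSurface α β) := chart_mem_atlas CTwo q
  have hsrc : q ∈ e.source := mem_chart_source CTwo q
  have htgt := e.map_source hsrc
  have hne := ne_zero_of_mem_chart_target α β hea htgt
  have hfd : MDifferentiableAt 𝓘(ℝ, CTwo) 𝓘(ℝ, ℝ) f q :=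
    (hsm.contMDiffAt (hU.mem_nhds hq)).mdifferentiableAt (by simp)
  have hFd : DifferentiableAt ℝ (fun y ↦ f (e.symm y)) (e q) := by
    have := hfd.differentiableWithinAt_writtenInExtChartAt
    simp only [mfld_simps, differentiableWithinAt_univ] at this
    exact this
  obtain ⟨Φ, hΦ, hΦ'⟩ := exists_primitive_neg hκ
  -- In the chart, f is compared with the explicit Kähler factor Φ(log ‖y‖²).
  have heq : fderiv ℝ (fun y ↦ f (e.symm y)) (e q) = logLeeForm κ (e q) := by
    refine eq_of_exp_smul_logMetric_closed hκ hne (hpos _) hFd.hasFDerivAt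
      (hasFDerivAt_log_weight hne (hΦ' _)) (fun u v w ↦ ?_)
      (fun u v w ↦ exp_smul_logMetric_closed hκ hΦ' hΦ hne u v w)
    have h := hcl e hea (e q) htgt (by rwa [e.left_inv hsrc]) u v w
    rw [(eventually_chartBilin_fundamentalForm hαβ hper hκ hpos f hea htgt).fderiv_eq] at h
    exact h
  exact mvfderiv_eq_of_hasFDerivAt hfd (hFd.hasFDerivAt.congr_fderiv heq)

theorem isLeeForm_hopfMetric_iff (hαβ : ‖α‖ = ‖β‖)
    (hper : Function.Periodic κ (2 * Real.log ‖α‖)) (hκ : ContDiff ℝ ∞ κ) (hpos : ∀ t, 0 < κ t)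
    (η : ∀ p : HopfSurface α β, TangentSpace 𝓘(ℝ, CTwo) p →L[ℝ] ℝ) :
    IsLeeForm (hopfMetric α β hαβ hper hκ hpos) η ↔ η = hopfLeeForm κ := by
  constructor
  · intro h
    funext p
    obtain ⟨U, f, hp, hf, hη⟩ := h p
    rw [hη p hp, mvfderiv_of_isKaehlerFactorOn hαβ hper hκ hpos hf hp]
  · rintro rfl p
    obtain ⟨f, hf⟩ := exists_isLogPotentialOn hαβ hper hκ p
    have hk := hf.isKaehlerFactorOn hαβ hper hκ hpos (chartAt CTwo p).open_source
    exact ⟨_, f, mem_chart_source CTwo p, hk, fun q hq ↦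
      (mvfderiv_of_isKaehlerFactorOn hαβ hper hκ hpos hk hq).symm⟩

/-! ### The Vaisman condition -/

theorem covariantDeriv_hopfLeeForm (hαβ : ‖α‖ = ‖β‖)
    (hper : Function.Periodic κ (2 * Real.log ‖α‖)) (hκ : ContDiff ℝ ∞ κ) (hpos : ∀ t, 0 < κ t)
    {e : OpenPartialHomeomorph (HopfSurface α β) CTwo} (he : e ∈ atlas CTwo (HopfSurface α β))
    {x : CTwo} (hx : x ∈ e.target) (u v : CTwo) :
    fderiv ℝ (chartForm (hopfLeeForm κ) e) x u v - chartForm (hopfLeeForm κ) e x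
      (christoffel (chartBilin (hopfMetric α β hαβ hper hκ hpos).inner e) x u v) =
      -2 * deriv κ (Real.log (reProd x x)) / reProd x x ^ 2 *
        (reProd x u * reProd x v + imProd x u * imProd x v) := by
  have h1 : chartForm (hopfLeeForm κ) e =ᶠ[𝓝 x] logLeeForm κ := by
    filter_upwards [e.open_target.mem_nhds hx] with y hy
    exact chartForm_hopfLeeForm hαβ hper he hy
  have h2 : chartBilin (hopfMetric α β hαβ hper hκ hpos).inner e =ᶠ[𝓝 x] logMetric κ := by
    filter_upwards [e.open_target.mem_nhds hx] with y hy
    exact chartBilin_hopfInner hαβ hper he hy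
  rw [← covariantDeriv_logLeeForm hκ (ne_zero_of_mem_chart_target α β he hx) (hpos _) u v,
    h1.fderiv_eq, h1.eq_of_nhds, christoffel, christoffel, h2.fderiv_eq, h2.eq_of_nhds]

theorem isVaisman_hopfMetric_iff (hαβ : ‖α‖ = ‖β‖)
    (hper : Function.Periodic κ (2 * Real.log ‖α‖)) (hκ : ContDiff ℝ ∞ κ) (hpos : ∀ t, 0 < κ t) :
    IsVaisman (hopfMetric α β hαβ hper hκ hpos) ↔ ∃ c : ℝ, ∀ t, κ t = c := by
  constructor
  · rintro ⟨-, η, hη, hpar⟩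
    rw [isLeeForm_hopfMetric_iff] at hη
    subst hη
    refine ⟨κ 0, fun t ↦ is_const_of_deriv_eq_zero (hκ.differentiable (by simp)) (fun s ↦ ?_) t 0⟩
    -- A point with log‖z‖² = s, so that κ' is tested at an arbitrary s. The preferred chart may
    -- represent it by a translate, which changes s by n periods.
    have hz : (!₂[(Real.exp (s / 2) : ℂ), 0] : CTwo) ≠ 0 := by
      intro h
      have h0 := congrArg (fun w : CTwo ↦ w 0) h
      simp [Complex.exp_ne_zero] at h0
    set z : puncturedCTwo := ⟨_, hz⟩ with hzdef
    obtain ⟨n, hn, -⟩ := mfderiv_hopfProj α β z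
    set x := chartAt CTwo (hopfProj α β z) (hopfProj α β z) with hx
    have hx0 : x ≠ 0 := ne_zero_of_mem_chart_target α β (chart_mem_atlas CTwo _)
      (mem_chart_target CTwo (hopfProj α β z))
    have hzz : reProd z.1 z.1 = Real.exp s := by
      simp only [hzdef, reProd_apply]
      simp [-Complex.ofReal_exp, ← Real.exp_add]
    have ha : 0 < ‖α ^ n‖ := norm_pos_iff.mpr (zpow_ne_zero n (ne_zero_of_one_lt_norm α))
    have hlog : Real.log (reProd x x) = s + n * (2 * Real.log ‖α‖) := by
      rw [hn, reProd_diagCLM (by simp [hαβ]), hzz, Real.log_mul (pow_pos ha 2).ne'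
        (Real.exp_ne_zero s), Real.log_exp, Real.log_pow, norm_zpow, Real.log_zpow]
      push_cast
      ring
    -- With u = v = x the tensor multiplying κ' equals ‖x‖⁴ and cancels the denominator.
    have h := hpar _ (chart_mem_atlas CTwo _) x (mem_chart_target CTwo (hopfProj α β z)) x x
    rw [covariantDeriv_hopfLeeForm hαβ hper hκ hpos (chart_mem_atlas CTwo _)
      (mem_chart_target CTwo (hopfProj α β z)), hlog, imProd_self] at h
    have hder : deriv κ (s + n * (2 * Real.log ‖α‖)) = deriv κ s := by
      rw [← deriv_comp_add_const]
      congr 1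
      funext t
      exact hper.int_mul n t
    have hs := (reProd_self_pos hx0).ne'
    rw [hder] at h
    have e : -2 * deriv κ s / reProd x x ^ 2 * (reProd x x * reProd x x + 0 * 0)
        = -2 * deriv κ s := by field_simp; ring
    linarith [e.symm.trans h]
  · rintro ⟨c, hc⟩
    refine ⟨isLCK_hopfMetric hαβ hper hκ hpos, hopfLeeForm κ,
      (isLeeForm_hopfMetric_iff hαβ hper hκ hpos _).mpr rfl, fun e he x hx u v ↦ ?_⟩
    rw [covariantDeriv_hopfLeeForm hαβ hper hκ hpos he hx]
    have : κ = fun _ ↦ c := funext hc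
    simp [this]

end HopfLeeForms

/-! ### The main theorem -/

theorem mainTheorem6 (α β : ℂ) [Fact (1 < ‖α‖)] [Fact (1 < ‖β‖)] (hαβ : ‖α‖ = ‖β‖)
    (k : ℝ → ℝ) (hk : ContDiff ℝ ∞ k) (hper : Function.Periodic k (2 * Real.pi))
    (hpos : ∀ θ, 0 < k θ) :
    ∃ g : SmoothMetric CTwo (HopfSurface α β),
      HasMatrixDiag α β k g ∧ (∀ g', HasMatrixDiag α β k g' → g' = g) ∧
      IsLCK g ∧ (IsVaisman g ↔ ∃ c : ℝ, ∀ θ, k θ = c) := by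
  have hL : 0 < Real.log ‖α‖ := Real.log_pos (Fact.out : 1 < ‖α‖)
  -- The reparametrization inverts t = θ log‖α‖ / π, turning the period 2π of k into the period 2
  -- log‖α‖ required for descent.
  set κ : ℝ → ℝ := fun t ↦ k (Real.pi * t / Real.log ‖α‖) with hκdef
  have hκ : ContDiff ℝ ∞ κ := hk.comp (by fun_prop)
  have hκper : Function.Periodic κ (2 * Real.log ‖α‖) := by
    intro t
    rw [hκdef]
    dsimp only
    rw [← hper (Real.pi * t / Real.log ‖α‖)]
    congr 1
    field_simp
  have hκpos : ∀ t, 0 < κ t := fun t ↦ hpos _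
  have hkκ : ∀ θ, κ (θ * Real.log ‖α‖ / Real.pi) = k θ := by
    intro θ
    rw [hκdef]
    dsimp only
    congr 1
    field_simp
  have hg := hasMatrixDiag_hopfMetric hαβ hκper hκ hκpos hkκ
  refine ⟨hopfMetric α β hαβ hκper hκ hκpos, hg, fun g' hg' ↦ hg.unique hαβ hg',
    isLCK_hopfMetric hαβ hκper hκ hκpos, ?_⟩
  rw [isVaisman_hopfMetric_iff]
  exact exists_congr fun c ↦ ⟨fun h θ ↦ (hkκ θ).symm.trans (h _), fun h t ↦ h _⟩
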